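/- **Quadratic geometries.** The language $L_Q$ has three sorts $K$, $V$, $Q$. It contains the language of rings on $K$, the language of abelian groups on $V$, scalar multiplication $K\times V\to V$, for each $n\ge 1$ an $n$-ary predicate $\theta_n$ on $V$ and functions $\pi_{n,i}:V^{n+1}\to K$ ($1\le i\le n$), and function symbols $\beta_V:V^2\to K$, $+_Q:Q\times V\to Q$, $-_Q:Q^2\to V$, $\beta_Q:Q\times V\to K$. The theory $T^0_Q$ asserts the following. - $K$ is a field of characteristic $2$ and $V$ is a $K$-vector space. - $\theta_n$ is linear independence. If $v_1,\dots,v_n$ are linearly independent and $w=\sum_i\alpha_iv_i$, then $\pi_{n,i}(v_1,\dots,v_n,w)=\alpha_i$; otherwise $\pi_{n,i}$ takes the value $0$. - $\beta_V$ is a non-degenerate alternating bilinear form on $V$. - For each $q\in Q$ the map $q(x):=\beta_Q(q,x)$ satisfies $q(\alpha x)=\alpha^2q(x)$ and $\beta_V(x,y)=q(x+y)-q(x)-q(y)$. - $+_Q$ is a regular action of $V$ on the (possibly empty) set $Q$, with $\beta_Q(q+_Qv,w)=\beta_Q(q,w)+\beta_V(v,w)^2$. - $q-_Qq'$ is the unique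 $v$ with $q'+_Qv=q$. The language $L_{Q,\omega}$ adds a function symbol $\omega:Q\to K$ (the Witt defect). The theory $T^0_{Q,\omega}$ adds to $T^0_Q$ the following axioms. - $\omega(q)\in\{0,1\}$. - $\omega(q_1)=\omega(q_2)$ if and only if $\beta_Q(q_1,q_1-_Qq_2)=x^2-x$ for some $x\in K$. - For each $n\ge 0$: if $\dim V=2n$, then $\omega(q)=0$ if and only if $(V,q)$ is an orthogonal direct sum of $n$ hyperbolic planes. Let $T^0$ be $T^0_Q$ or $T^0_{Q,\omega}$. A model $M$ of $T^0$ is *pseudo-finite* if it is infinite and every sentence true in $M$ is true in some finite model of $T^0$. Let $\mathrm{PSF}_2$ be the theory of pseudo-finite fields of characteristic $2$, that is, of the infinite fields of characteristic $2$ in which every sentence true in all finite fields holds. **Theorem.** For $T^0=T^0_Q$ and for $T^0=T^0_{Q,\omega}$: if $M\models T^0$ is pseudo-finite with $Q(M)\ne\emptyset$, then $\mathrm{Th}(M)$ is axiomatized, modulo $T^0$, by one of the following sets of axioms. 1. For some $k\ge1$: $|K|=2^k$, $V$ has infinite dimension, and $Q\neq\emptyset$. 2. For some completion $T_K$ of $\mathrm{PSF}_2$: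 $K\models T_K$, $Q\ne\emptyset$, and one of the following: - (a) $\dim V=2n$, for some $n\ge0$; - (b) $V$ has infinite dimension. Moreover, all of these possibilities are realized: for every $k\ge 1$, for every completion $T_K$ of $\mathrm{PSF}_2$ and every $n\ge0$, and for every completion $T_K$ of $\mathrm{PSF}_2$, respectively, there is a pseudo-finite $M\models T^0$ with $Q(M)\neq\emptyset$ such that $\mathrm{Th}(M)$ is axiomatized, modulo $T^0$, by the axioms in (1), in (2)(a), and in (2)(b), respectively. -/

import Mathlib

universe u

/-! # Many-sorted first-order logic -/

namespace ManySorted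

/-- A many-sorted language with set of sorts `S`: a function symbol has an arity
`a : Fin n → S` (the sorts of its arguments) and a value sort; a relation symbol has an arity. -/
structure Language (S : Type) : Type 1 where
  Functions : {n : ℕ} → (Fin n → S) → S → Type
  Relations : {n : ℕ} → (Fin n → S) → Type

variable {S : Type}

/-- A structure for a many-sorted language. The sorts may be empty. -/
structure Str (L : Language S) : Type (u + 1) where
  Carrier : S → Type u
  funMap : {n : ℕ} → {a : Fin n → S} → {s : S} →
    L.Functions a s → (∀ i, Carrier (a i)) → Carrier s
  relMap : {n : ℕ} → {a : Fin n → S} → L.Relations a → (∀ i, Carrier (a i)) → Prop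

/-- `Var Γ s` is the type of variables of sort `s` in the context `Γ` (a finite list of sorts). -/
inductive Var : List S → S → Type
  | zero {Γ : List S} {s : S} : Var (s :: Γ) s
  | succ {Γ : List S} {s t : S} : Var Γ s → Var (t :: Γ) s

/-- Terms of sort `s` whose variables are in the context `Γ`. -/
inductive Term (L : Language S) (Γ : List S) : S → Type
  | var {s : S} : Var Γ s → Term L Γ s
  | func {n : ℕ} {a : Fin n → S} {s : S} :
      L.Functions a s → (∀ i, Term L Γ (a i)) → Term L Γ s

/-- First-order formulas whose free variables are in the context `Γ`. -/
inductive Formula (L : Language S) : List S → Type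
  | falsum {Γ : List S} : Formula L Γ
  | equal {Γ : List S} {s : S} : Term L Γ s → Term L Γ s → Formula L Γ
  | rel {Γ : List S} {n : ℕ} {a : Fin n → S} :
      L.Relations a → (∀ i, Term L Γ (a i)) → Formula L Γ
  | imp {Γ : List S} : Formula L Γ → Formula L Γ → Formula L Γ
  | all {Γ : List S} (s : S) : Formula L (s :: Γ) → Formula L Γ

/-- Sentences are formulas without free variables. -/
abbrev Sentence (L : Language S) : Type := Formula L []

namespace Formula

variable {L : Language S} {Γ : List S}

def not (φ : Formula L Γ) : Formula L Γ := φ.imp falsum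

def verum : Formula L Γ := not falsum

def and (φ ψ : Formula L Γ) : Formula L Γ := not (φ.imp (not ψ))

def ex (s : S) (φ : Formula L (s :: Γ)) : Formula L Γ := not (all s (not φ))

/-- The existential closure of a formula in `m` variables, all of the sort `s`. -/
def exs (s : S) : (m : ℕ) → Formula L (List.replicate m s) → Sentence L
  | 0, φ => φ
  | m + 1, φ => exs s m (ex s φ)

end Formula

/-- The `i`-th variable of a context consisting of `m` variables of the sort `s`. -/
def Var.replicate (s : S) : (m : ℕ) → Fin m → Var (List.replicate m s) s
  | _ + 1, ⟨0, _⟩ => Var.zero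
  | m + 1, ⟨i + 1, h⟩ => Var.succ (Var.replicate s m ⟨i, Nat.lt_of_succ_lt_succ h⟩)

/-- Assignments of values to the variables in the context `Γ`. -/
abbrev Assignment {L : Language S} (M : Str.{u} L) (Γ : List S) : Type u :=
  ∀ s, Var Γ s → M.Carrier s

def Assignment.nil {L : Language S} (M : Str.{u} L) : Assignment M [] := fun _ x => nomatch x

def Assignment.cons {L : Language S} {M : Str.{u} L} {Γ : List S} {t : S}
    (x : M.Carrier t) (v : Assignment M Γ) : Assignment M (t :: Γ)
  | _, .zero => x
  | _, .succ i => v _ i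

def Term.eval {L : Language S} (M : Str.{u} L) {Γ : List S} (v : Assignment M Γ) :
    {s : S} → Term L Γ s → M.Carrier s
  | _, .var x => v _ x
  | _, .func f ts => M.funMap f (fun i => (ts i).eval M v)

/-- Satisfaction of a formula in a structure under an assignment. -/
def Formula.Realize {L : Language S} (M : Str.{u} L) :
    {Γ : List S} → Formula L Γ → Assignment M Γ → Prop
  | _, .falsum, _ => False
  | _, .equal t₁ t₂, v => t₁.eval M v = t₂.eval M v
  | _, .rel R ts, v => M.relMap R (fun i => (ts i).eval M v)
  | _, .imp φ ψ, v => φ.Realize M v → ψ.Realize M v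
  | _, .all s φ, v => ∀ x : M.Carrier s, φ.Realize M (Assignment.cons x v)

/-- `M` satisfies the sentence `φ`. -/
def Str.Satisfies {L : Language S} (M : Str.{u} L) (φ : Sentence L) : Prop :=
  φ.Realize M (Assignment.nil M)

/-- A structure is finite if all its sorts are finite (there are finitely many sorts in
all the languages below). -/
def Str.IsFinite {L : Language S} (M : Str.{u} L) : Prop := ∀ s, Finite (M.Carrier s)

/-- `T` is the class of models of a theory. A model `M` of the theory is pseudo-finite if it is
infinite and each sentence true in `M` is true in some finite model of the theory. -/
def IsPseudoFinite {L : Language S} (T : Set (Str.{u} L)) (M : Str.{u} L) : Prop :=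
  M ∈ T ∧ ¬ M.IsFinite ∧ ∀ φ : Sentence L, M.Satisfies φ → ∃ N ∈ T, N.IsFinite ∧ N.Satisfies φ

/-- `T` is the class of models of a theory. The complete theory of `M` is axiomatized, modulo
that theory, by the set of sentences `X`: it consists exactly of the logical consequences of `X`
together with the theory. -/
def IsAxiomatizedModulo {L : Language S} (T : Set (Str.{u} L)) (X : Set (Sentence L))
    (M : Str.{u} L) : Prop :=
  ∀ φ : Sentence L,
    M.Satisfies φ ↔ ∀ N ∈ T, (∀ ψ ∈ X, N.Satisfies ψ) → N.Satisfies φ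

end ManySorted

/-! # Quadratic geometries -/

namespace QuadGeom

open ManySorted

/-- The three sorts: field, vector space, quadratic forms. -/
inductive Srt : Type
  | K | V | Q

/-- The function symbols of `L_Q` (for `w = false`) and of `L_{Q,ω}` (for `w = true`). -/
inductive Func (w : Bool) : {n : ℕ} → (Fin n → Srt) → Srt → Type
  /-- the symbols `+, *, -, 0, 1` of the language of rings, on the sort `K` -/
  | ring {n : ℕ} (f : FirstOrder.Language.ring.Functions n) : Func w (fun _ : Fin n => Srt.K) Srt.K
  /-- the symbols of the language of abelian groups, on the sort `V` -/
  | vzero : Func w ![] Srt.V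
  | vadd : Func w ![Srt.V, Srt.V] Srt.V
  | vneg : Func w ![Srt.V] Srt.V
  /-- scalar multiplication -/
  | smul : Func w ![Srt.K, Srt.V] Srt.V
  /-- the coordinate functions `π_{n,i}` -/
  | coord (n : ℕ) (i : Fin n) : Func w (fun _ : Fin (n + 1) => Srt.V) Srt.K
  /-- the bilinear form `β_V` -/
  | betaV : Func w ![Srt.V, Srt.V] Srt.K
  /-- the action `+_Q` of `V` on `Q` -/
  | addQ : Func w ![Srt.Q, Srt.V] Srt.Q
  /-- the difference `-_Q` of two elements of `Q` -/
  | subQ : Func w ![Srt.Q, Srt.Q] Srt.V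
  /-- the evaluation `β_Q` of an element of `Q` at a vector -/
  | betaQ : Func w ![Srt.Q, Srt.V] Srt.K
  /-- the Witt defect, only in `L_{Q,ω}` -/
  | omega (h : w = true) : Func w ![Srt.Q] Srt.K

/-- The relation symbols: the linear independence predicates `θ_n`. -/
inductive Rel : {n : ℕ} → (Fin n → Srt) → Type
  | theta (n : ℕ) (hn : 1 ≤ n) : Rel (fun _ : Fin n => Srt.V)

/-- The language `L_Q` (for `w = false`) or `L_{Q,ω}` (for `w = true`). -/
def lang (w : Bool) : ManySorted.Language Srt where
  Functions := Func w
  Relations := Rel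

/-- A quadratic geometry, given by its algebraic data. `Q` may be empty. -/
structure QuadraticGeometry : Type (u + 1) where
  K : Type u
  V : Type u
  Q : Type u
  [field : Field K]
  [addCommGroup : AddCommGroup V]
  [module : Module K V]
  charTwo : CharP K 2
  betaV : V →ₗ[K] V →ₗ[K] K
  betaV_alternating : ∀ x, betaV x x = 0
  betaV_nondegenerate : ∀ x, (∀ y, betaV x y = 0) → x = 0
  betaQ : Q → V → K
  betaQ_smul : ∀ q (a : K) x, betaQ q (a • x) = a ^ 2 * betaQ q x
  betaV_eq : ∀ q x y, betaV x y = betaQ q (x + y) - betaQ q x - betaQ q y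
  addQ : Q → V → Q
  addQ_zero : ∀ q, addQ q 0 = q
  addQ_add : ∀ q v w, addQ q (v + w) = addQ (addQ q v) w
  addQ_regular : ∀ q q', ∃! v, addQ q v = q'
  betaQ_addQ : ∀ q v w, betaQ (addQ q v) w = betaQ q w + betaV v w ^ 2
  subQ : Q → Q → V
  addQ_subQ : ∀ q q', addQ q' (subQ q q') = q

attribute [instance] QuadraticGeometry.field QuadraticGeometry.addCommGroup
  QuadraticGeometry.module

namespace QuadraticGeometry

variable (G : QuadraticGeometry.{u})

/-- The orthogonal space `(V, q)` is a (possibly empty) orthogonal direct sum of finitely many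
hyperbolic planes: it has a basis `e_1, …, e_n, f_1, …, f_n` with `q(e_i) = q(f_i) = 0`,
`β(e_i, f_i) = 1` and all other values of `β` equal to `0`. -/
def IsHyperbolic (q : G.Q) : Prop :=
  ∃ (n : ℕ) (b : Module.Basis (Fin n ⊕ Fin n) G.K G.V),
    (∀ i, G.betaQ q (b i) = 0) ∧
    (∀ i j : Fin n, G.betaV (b (.inl i)) (b (.inr j)) = if i = j then 1 else 0) ∧
    (∀ i j : Fin n, G.betaV (b (.inl i)) (b (.inl j)) = 0) ∧
    (∀ i j : Fin n, G.betaV (b (.inr i)) (b (.inr j)) = 0)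

/-- The axioms for the Witt defect `ω : Q → K`. -/
structure IsWittDefect (ω : G.Q → G.K) : Prop where
  zero_or_one : ∀ q, ω q = 0 ∨ ω q = 1
  eq_iff : ∀ q₁ q₂, ω q₁ = ω q₂ ↔ ∃ x : G.K, G.betaQ q₁ (G.subQ q₁ q₂) = x ^ 2 - x
  eq_zero_iff : ∀ n : ℕ, Module.Finite G.K G.V → Module.finrank G.K G.V = 2 * n →
    ∀ q, ω q = 0 ↔ G.IsHyperbolic q

/-- The carrier of each sort. -/
def carrier : Srt → Type u
  | .K => G.K
  | .V => G.V
  | .Q => G.Q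

open Classical in
/-- The `i`-th coordinate of `x` with respect to `v` if `v` is linearly independent and `x` is
in its span, and `0` otherwise. -/
noncomputable def coordinate {n : ℕ} (v : Fin n → G.V) (x : G.V) (i : Fin n) : G.K :=
  if h : LinearIndependent G.K v ∧ x ∈ Submodule.span G.K (Set.range v) then
    h.1.repr ⟨x, h.2⟩ i
  else 0

/-- Interpretation of the function symbols, where `ω` interprets the Witt defect if it is
in the language. In `coord n i`, the last argument is the vector whose coordinate is taken. -/
noncomputable def interpFunc {w : Bool} (ω : w = true → G.Q → G.K) :
    {n : ℕ} → {a : Fin n → Srt} → {s : Srt} →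
      Func w a s → (∀ i, G.carrier (a i)) → G.carrier s
  | _, _, _, .ring f, x =>
      let a : Fin _ → G.K := x
      (FirstOrder.Ring.compatibleRingOfRing G.K).toStructure.funMap f a
  | _, _, _, .vzero, _ => (0 : G.V)
  | _, _, _, .vadd, x =>
      let v₁ : G.V := x 0
      let v₂ : G.V := x 1
      v₁ + v₂
  | _, _, _, .vneg, x =>
      let v : G.V := x 0
      Neg.neg (α := G.V) v
  | _, _, _, .smul, x =>
      let a : G.K := x 0
      let v : G.V := x 1
      a • v
  | _, _, _, .coord n i, x =>
      let v : Fin (n + 1) → G.V := x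
      G.coordinate (fun j : Fin n => v j.castSucc) (v (Fin.last n)) i
  | _, _, _, .betaV, x => G.betaV (x 0) (x 1)
  | _, _, _, .addQ, x => G.addQ (x 0) (x 1)
  | _, _, _, .subQ, x => G.subQ (x 0) (x 1)
  | _, _, _, .betaQ, x => G.betaQ (x 0) (x 1)
  | _, _, _, .omega h, x => ω h (x 0)

/-- Interpretation of the linear independence predicates. -/
def interpRel : {n : ℕ} → {a : Fin n → Srt} → Rel a → (∀ i, G.carrier (a i)) → Prop
  | _, _, .theta n _, x =>
      let v : Fin n → G.V := x
      LinearIndependent G.K v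

/-- A quadratic geometry as a three-sorted structure. -/
noncomputable def toStr (w : Bool) (ω : w = true → G.Q → G.K) : Str.{u} (lang w) where
  Carrier := G.carrier
  funMap := G.interpFunc ω
  relMap := G.interpRel

end QuadraticGeometry

/-- The class of models of `T⁰_Q` (for `w = false`), the quadratic geometries, or of `T⁰_{Q,ω}`
(for `w = true`), the quadratic geometries with Witt defect. -/
def baseTheory (w : Bool) : Set (Str.{u} (lang w)) :=
  {M | ∃ (G : QuadraticGeometry.{u}) (ω : w = true → G.Q → G.K),
    (∀ h : w = true, G.IsWittDefect (ω h)) ∧ M = G.toStr w ω}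

/-! ## Theories of fields -/

open FirstOrder FirstOrder.Language FirstOrder.Ring in
/-- The theory of pseudo-finite fields of characteristic `2`: the sentences in the language of
rings that hold in all finite fields, together with the assertions that the field is infinite
and of characteristic `2`. -/
noncomputable def PSF2 : FirstOrder.Language.ring.Theory :=
  {σ | ∀ (F : Type) [Field F] [Finite F] [CompatibleRing F], F ⊨ σ} ∪
    FirstOrder.Language.ring.infiniteTheory ∪ Theory.fieldOfChar 2

/-- `T` is a completion of `PSF2`: a maximal satisfiable set of sentences containing `PSF2`. -/
def IsCompletionPSF2 (T : FirstOrder.Language.ring.Theory) : Prop :=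
  PSF2 ⊆ T ∧ T.IsMaximal

/-- A term in the language of rings, read as a term of the sort `K`; `ρ` renames the variables. -/
def ringTerm (w : Bool) {Γ : List Srt} {n : ℕ} (ρ : Fin n → Var Γ Srt.K) :
    FirstOrder.Language.ring.Term (Empty ⊕ Fin n) → Term (lang w) Γ Srt.K
  | .var (.inl e) => e.elim
  | .var (.inr i) => .var (ρ i)
  | .func f ts => .func (L := lang w) (Func.ring f) (fun i => ringTerm w ρ (ts i))

/-- A formula in the language of rings, read as an assertion about the sort `K`. -/
def ringFormula (w : Bool) :
    {n : ℕ} → FirstOrder.Language.ring.BoundedFormula Empty n →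
      {Γ : List Srt} → (Fin n → Var Γ Srt.K) → Formula (lang w) Γ
  | _, .falsum, _, _ => .falsum
  | _, .equal t₁ t₂, _, ρ => .equal (ringTerm w ρ t₁) (ringTerm w ρ t₂)
  | _, .rel R _, _, _ => isEmptyElim R
  | _, .imp φ ψ, _, ρ => .imp (ringFormula w φ ρ) (ringFormula w ψ ρ)
  | n, .all φ, _, ρ =>
      .all Srt.K (ringFormula w φ
        (Fin.snoc (α := fun _ : Fin (n + 1) => Var (Srt.K :: _) Srt.K)
          (fun i => Var.succ (ρ i)) Var.zero))

/-- A sentence in the language of rings, read as an assertion about the field `K`. -/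
def aboutK (w : Bool) (σ : FirstOrder.Language.ring.Sentence) : Sentence (lang w) :=
  ringFormula w σ (fun i => i.elim0)

/-! ## The axioms for the pseudo-finite completions -/

variable (w : Bool)

/-- `Q ≠ ∅`. -/
def nonemptyQ : Sentence (lang w) :=
  .ex Srt.Q (.equal (.var Var.zero) (.var Var.zero))

/-- `dim V ≥ m`: there exist `m` linearly independent vectors. -/
def dimGe : ℕ → Sentence (lang w)
  | 0 => .verum
  | m + 1 => .exs Srt.V (m + 1)
      (.rel (L := lang w) (Rel.theta (m + 1) (Nat.le_add_left 1 m))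
        (fun i => .var (Var.replicate Srt.V (m + 1) i)))

/-- `dim V = m`. -/
def dimEq (m : ℕ) : Sentence (lang w) := .and (dimGe w m) (.not (dimGe w (m + 1)))

/-- `V` has infinite dimension. -/
def dimInfinite : Set (Sentence (lang w)) := Set.range (dimGe w)

/-- `K` has exactly `m` elements. -/
def cardKEq (m : ℕ) : Sentence (lang w) :=
  .and (aboutK w (FirstOrder.Language.Sentence.cardGe _ m))
    (.not (aboutK w (FirstOrder.Language.Sentence.cardGe _ (m + 1))))

/-- `K` is a finite field of cardinality `2 ^ k`, `V` has infinite dimension, `Q ≠ ∅`. -/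
def finiteFieldAxioms (k : ℕ) : Set (Sentence (lang w)) :=
  {cardKEq w (2 ^ k)} ∪ dimInfinite w ∪ {nonemptyQ w}

/-- `Th(K)` is `T`, `V` has dimension `2 n`, `Q ≠ ∅`. -/
def finiteDimAxioms (T : FirstOrder.Language.ring.Theory) (n : ℕ) : Set (Sentence (lang w)) :=
  aboutK w '' T ∪ {dimEq w (2 * n)} ∪ {nonemptyQ w}

/-- `Th(K)` is `T`, `V` has infinite dimension, `Q ≠ ∅`. -/
def infiniteDimAxioms (T : FirstOrder.Language.ring.Theory) : Set (Sentence (lang w)) :=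
  aboutK w '' T ∪ dimInfinite w ∪ {nonemptyQ w}

end QuadGeom

/-!
The theorem rests on a relative quantifier elimination down to the field: in a quadratic geometry,
the truth of a sentence is governed by a single sentence about the field `K`, which depends on the
dimension of `V` only through whether it is large, or which even number it is.

A finite tuple of elements of a geometry is described by field elements. Fix independent vectors
`e_1, …, e_m` and a base point `q ∈ Q` of trivial Witt defect (a `Frame`). Elements of the span,
and elements `q + v` of `Q` with `v` in the span, have coordinates in `K`, and together with the
Gram data `β(e_i, e_j)`, `q(e_i)` these determine the values of all terms by functions that are
definable in the language of rings, uniformly in all fields (`exists_definable_term`); the Witt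
defect of `q + v` is the class of `q(v)` modulo the subgroup of elements `x² - x`. Quantification
over the span is quantification over coordinates. If the `e_i` do not span `V`, one also
quantifies over vectors `v` outside the span. If `K` is perfect and the dimension is large, such a
`v` may have arbitrary values `β(e_i, v)` and `q(v)` (`QuadraticGeometry.exists_extension`), so
this is quantification over new Gram data. By induction on formulas, truth of a formula becomes a
definable property of the data (`exists_definable_formula`). For a sentence one takes `m = 0` in
the case of large dimension; in dimension `2 n` one takes a hyperbolic basis, whose Gram data are
constants. Both choices are possible when `K` is perfect and the elements `x² - x` form a subgroup
of index `2`, which holds in finite fields of characteristic `2` and hence in the models of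
`PSF2`. It follows at once that the axioms are complete.

Pseudo-finite models are obtained from the standard geometry on `K^I × K^I`. A sentence true in it
reduces to a sentence about `K`, which holds in a finite field of characteristic `2`, since
otherwise its negation would belong to the completion of `PSF2`; so the original sentence holds in
a finite standard geometry, of large dimension if `I` is infinite. The standard geometry carries a
Witt defect because of the invariance of the Arf invariant: if `q` is hyperbolic, then so is
`q + v` if and only if `q(v)` has the form `x² - x`
(`QuadraticGeometry.IsHyperbolic.exists_betaQ_eq`, by comparison of Lagrangians, and
`QuadraticGeometry.IsHyperbolic.addQ`, by a transvection).

Conversely, if `M` is pseudo-finite with an infinite field, then the theory of the field is a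
completion of `PSF2`, since sentences about the field are sentences about `M`; and the dimension
is even or infinite, since a finite-dimensional geometry has a symplectic basis.
-/

namespace QuadGeom

/-! ### Uniformly definable predicates and functions on fields -/

section Definability

open FirstOrder FirstOrder.Language FirstOrder.Ring

/-- A property of `α`-tuples, given for all fields of the universe `u` at once. -/
abbrev FieldPred (α : Type) : Type (u + 1) := ∀ (K : Type u) [Field K], (α → K) → Prop

/-- A function of `α`-tuples, given for all fields of the universe `u` at once. -/
abbrev FieldFun (α : Type) : Type (u + 1) := ∀ (K : Type u) [Field K], (α → K) → K

/-- A predicate is definable if one formula in the language of rings expresses it in every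
field. -/
def FieldPred.Definable {α : Type} (P : FieldPred.{u} α) : Prop :=
  ∃ ψ : Language.ring.Formula α, ∀ (K : Type u) [Field K] (c : α → K),
    P K c ↔ (letI := compatibleRingOfRing K; ψ.Realize c)

/-- A function is definable if its graph is; the value of the function is the coordinate
`none`. -/
def FieldFun.Definable {α : Type} (F : FieldFun.{u} α) : Prop :=
  FieldPred.Definable.{u} (α := Option α) fun K _ c => c none = F K (fun a => c (some a))

namespace FieldPred.Definable

variable {α β : Type}

theorem congr {P P' : FieldPred.{u} α} (h : P.Definable)
    (e : ∀ (K : Type u) [Field K] (c : α → K), P' K c ↔ P K c) : P'.Definable := by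
  obtain ⟨ψ, hψ⟩ := h
  exact ⟨ψ, fun K _ c => (e K c).trans (hψ K c)⟩

theorem falsum : FieldPred.Definable.{u} (α := α) fun _ _ _ => False :=
  ⟨⊥, fun K _ c => by simp⟩

theorem imp {P P' : FieldPred.{u} α} (h : P.Definable) (h' : P'.Definable) :
    FieldPred.Definable.{u} fun K _ (c : α → K) => P K c → P' K c := by
  obtain ⟨ψ, hψ⟩ := h
  obtain ⟨ψ', hψ'⟩ := h'
  exact ⟨ψ.imp ψ', fun K _ c => by
    let _ := compatibleRingOfRing K
    rw [Formula.realize_imp, ← hψ, ← hψ']⟩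

theorem not {P : FieldPred.{u} α} (h : P.Definable) :
    FieldPred.Definable.{u} fun K _ (c : α → K) => ¬ P K c :=
  h.imp falsum

theorem and {P P' : FieldPred.{u} α} (h : P.Definable) (h' : P'.Definable) :
    FieldPred.Definable.{u} fun K _ (c : α → K) => P K c ∧ P' K c :=
  (h.imp h'.not).not.congr fun K _ c => by tauto

theorem or {P P' : FieldPred.{u} α} (h : P.Definable) (h' : P'.Definable) :
    FieldPred.Definable.{u} fun K _ (c : α → K) => P K c ∨ P' K c :=
  (h.not.imp h').congr fun K _ c => by tauto

theorem const (p : Prop) : FieldPred.Definable.{u} (α := α) fun _ _ _ => p := by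
  by_cases hp : p
  · exact (falsum.imp falsum).congr fun K _ c => by simp [hp]
  · exact falsum.congr fun K _ c => by simp [hp]

/-- Definability is preserved under finite conjunctions. -/
theorem forall_index {ι : Type} [Finite ι] {P : ι → FieldPred.{u} α}
    (h : ∀ i, (P i).Definable) :
    FieldPred.Definable.{u} fun K _ (c : α → K) => ∀ i, P i K c := by
  choose ψ hψ using h
  exact ⟨Formula.iInf ψ, fun K _ c => by
    let _ := compatibleRingOfRing K
    rw [Formula.realize_iInf]
    exact forall_congr' fun i => hψ i K c⟩

theorem relabel {P : FieldPred.{u} α} (h : P.Definable) (g : α → β) :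
    FieldPred.Definable.{u} fun K _ (c : β → K) => P K (fun a => c (g a)) := by
  obtain ⟨ψ, hψ⟩ := h
  exact ⟨ψ.relabel g, fun K _ c => by
    let _ := compatibleRingOfRing K
    rw [Formula.realize_relabel]
    exact hψ K _⟩

/-- Definability is preserved under quantification over finite tuples of field elements. -/
theorem forall_tuple {ι : Type} [Finite ι]
    {P : ∀ (K : Type u) [Field K], (α → K) → (ι → K) → Prop}
    (h : FieldPred.Definable.{u} (α := α ⊕ ι) fun K _ c =>
      P K (fun a => c (.inl a)) (fun i => c (.inr i))) :
    FieldPred.Definable.{u} fun K _ (c : α → K) => ∀ y : ι → K, P K c y := by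
  obtain ⟨ψ, hψ⟩ := h
  exact ⟨ψ.iAlls ι, fun K _ c => by
    let _ := compatibleRingOfRing K
    rw [Formula.realize_iAlls]
    exact forall_congr' fun y => hψ K (Sum.elim c y)⟩

theorem exists_tuple {ι : Type} [Finite ι]
    {P : ∀ (K : Type u) [Field K], (α → K) → (ι → K) → Prop}
    (h : FieldPred.Definable.{u} (α := α ⊕ ι) fun K _ c =>
      P K (fun a => c (.inl a)) (fun i => c (.inr i))) :
    FieldPred.Definable.{u} fun K _ (c : α → K) => ∃ y : ι → K, P K c y :=
  (forall_tuple (P := fun K _ c y => ¬ P K c y) h.not).not.congr fun K _ c => by simp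

theorem exists_elem {P : ∀ (K : Type u) [Field K], (α → K) → K → Prop}
    (h : FieldPred.Definable.{u} (α := Option α) fun K _ c =>
      P K (fun a => c (some a)) (c none)) :
    FieldPred.Definable.{u} fun K _ (c : α → K) => ∃ y : K, P K c y := by
  have h1 := h.relabel (β := α ⊕ Unit) (fun o => o.elim (.inr ()) .inl)
  exact (exists_tuple (ι := Unit) (P := fun K _ c y => P K c (y ())) h1).congr fun K _ c =>
    ⟨fun ⟨y, hy⟩ => ⟨fun _ => y, hy⟩, fun ⟨y, hy⟩ => ⟨y (), hy⟩⟩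

/-- Substitution of definable functions into a definable predicate. -/
theorem comp [Finite α] {P : FieldPred.{u} α} (h : P.Definable)
    {F : α → FieldFun.{u} β} (hF : ∀ a, (F a).Definable) :
    FieldPred.Definable.{u} fun K _ (c : β → K) => P K (fun a => F a K c) := by
  have h1 : FieldPred.Definable.{u} (α := β ⊕ α) fun K _ c =>
      (∀ a, c (.inr a) = F a K (fun b => c (.inl b))) ∧ P K (fun a => c (.inr a)) :=
    (forall_index fun a => FieldPred.Definable.relabel (β := β ⊕ α) (hF a)
      (fun o => o.elim (Sum.inr a) Sum.inl)).and (h.relabel Sum.inr)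
  exact (exists_tuple (P := fun K _ c y => (∀ a, y a = F a K c) ∧ P K y) h1).congr
    fun K _ c => ⟨fun hP => ⟨_, fun _ => rfl, hP⟩, fun ⟨y, hy, hP⟩ => by
      rwa [funext hy] at hP⟩

theorem equal {F G : FieldFun.{u} α} (hF : F.Definable) (hG : G.Definable) :
    FieldPred.Definable.{u} fun K _ (c : α → K) => F K c = G K c := by
  have h1 : FieldPred.Definable.{u} (α := Option α) fun K _ c =>
      c none = F K (fun a => c (some a)) ∧ c none = G K (fun a => c (some a)) := hF.and hG
  exact (exists_elem (P := fun K _ c y => y = F K c ∧ y = G K c) h1).congr fun K _ c => by simp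

end FieldPred.Definable

namespace FieldFun.Definable

variable {α β : Type}

theorem of_term (t : Language.ring.Term α) (F : FieldFun.{u} α)
    (h : ∀ (K : Type u) [Field K] (c : α → K),
      F K c = (letI := compatibleRingOfRing K; t.realize c)) : F.Definable :=
  ⟨Term.equal (Term.var none) (t.relabel some), fun K _ c => by
    let _ := compatibleRingOfRing K
    rw [Formula.realize_equal, Term.realize_relabel]
    exact Eq.congr_right (h K _)⟩

theorem proj (a : α) : FieldFun.Definable.{u} fun _ _ c => c a :=
  of_term (Term.var a) _ fun _ _ _ => rfl

theorem zero : FieldFun.Definable.{u} (α := α) fun _ _ _ => 0 :=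
  of_term 0 _ fun K _ c => by
    let _ := compatibleRingOfRing K
    simp

theorem one : FieldFun.Definable.{u} (α := α) fun _ _ _ => 1 :=
  of_term 1 _ fun K _ c => by
    let _ := compatibleRingOfRing K
    simp

theorem comp [Finite α] {F : FieldFun.{u} α} (h : F.Definable) {G : α → FieldFun.{u} β}
    (hG : ∀ a, (G a).Definable) :
    FieldFun.Definable.{u} fun K _ (c : β → K) => F K (fun a => G a K c) := by
  refine FieldPred.Definable.comp h
    (F := fun o K _ c => o.elim (c none) fun a => G a K fun b => c (some b)) ?_
  rintro (_ | a)
  · exact proj none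
  · exact FieldPred.Definable.relabel (hG a)
      (fun o : Option β => o.elim none fun b => some (some b))

variable {F G : FieldFun.{u} α}

theorem add (hF : F.Definable) (hG : G.Definable) :
    FieldFun.Definable.{u} fun K _ (c : α → K) => F K c + G K c := by
  have h : FieldFun.Definable.{u} (α := Bool) fun K _ c => c true + c false :=
    of_term (Term.var true + Term.var false) _ fun K _ c => by
      let _ := compatibleRingOfRing K
      simp
  exact h.comp (G := fun b => bif b then F else G) (by simp [hF, hG])

theorem mul (hF : F.Definable) (hG : G.Definable) :
    FieldFun.Definable.{u} fun K _ (c : α → K) => F K c * G K c := by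
  have h : FieldFun.Definable.{u} (α := Bool) fun K _ c => c true * c false :=
    of_term (Term.var true * Term.var false) _ fun K _ c => by
      let _ := compatibleRingOfRing K
      simp
  exact h.comp (G := fun b => bif b then F else G) (by simp [hF, hG])

theorem neg (hF : F.Definable) :
    FieldFun.Definable.{u} fun K _ (c : α → K) => - F K c := by
  have h : FieldFun.Definable.{u} (α := Unit) fun K _ c => - c () :=
    of_term (-Term.var ()) _ fun K _ c => by
      let _ := compatibleRingOfRing K
      simp
  exact h.comp (G := fun _ => F) fun _ => hF

theorem sub (hF : F.Definable) (hG : G.Definable) :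
    FieldFun.Definable.{u} fun K _ (c : α → K) => F K c - G K c := by
  simpa only [sub_eq_add_neg] using hF.add hG.neg

theorem sq (hF : F.Definable) :
    FieldFun.Definable.{u} fun K _ (c : α → K) => F K c ^ 2 := by
  simpa only [pow_two] using hF.mul hF

theorem sum {ι : Type} (s : Finset ι) {F : ι → FieldFun.{u} α} (hF : ∀ i, (F i).Definable) :
    FieldFun.Definable.{u} fun K _ (c : α → K) => ∑ i ∈ s, F i K c := by
  classical
  induction s using Finset.induction_on with
  | empty => simpa only [Finset.sum_empty] using zero
  | insert i s hi ih => simpa only [Finset.sum_insert hi] using (hF i).add ih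

open Classical in
theorem ite {P : FieldPred.{u} α} (hP : P.Definable) (hF : F.Definable) (hG : G.Definable) :
    FieldFun.Definable.{u} fun K _ (c : α → K) => if P K c then F K c else G K c := by
  have h : FieldPred.Definable.{u} (α := Option α) fun K _ c =>
      (P K fun a => c (some a)) ∧ c none = F K (fun a => c (some a)) ∨
      ¬ (P K fun a => c (some a)) ∧ c none = G K (fun a => c (some a)) :=
    ((hP.relabel some).and hF).or ((hP.relabel some).not.and hG)
  exact h.congr fun K _ c => by by_cases hc : P K (fun a => c (some a)) <;> simp [hc]

theorem ite_const (p : Prop) [Decidable p] (hF : F.Definable) (hG : G.Definable) :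
    FieldFun.Definable.{u} fun K _ (c : α → K) => if p then F K c else G K c := by
  split_ifs
  · exact hF
  · exact hG

end FieldFun.Definable

end Definability

/-! ### Linear algebra of quadratic geometries -/

namespace QuadraticGeometry

variable (G : QuadraticGeometry.{u})

instance : CharP G.K 2 := G.charTwo

theorem betaV_comm (x y : G.V) : G.betaV x y = G.betaV y x := by
  have h : G.betaV.IsAlt := G.betaV_alternating
  rw [← h.neg, CharTwo.neg_eq]

theorem betaQ_zero (q : G.Q) : G.betaQ q 0 = 0 := by
  simpa using G.betaQ_smul q 0 0

theorem betaQ_add (q : G.Q) (x y : G.V) :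
    G.betaQ q (x + y) = G.betaQ q x + G.betaQ q y + G.betaV x y := by
  rw [G.betaV_eq q]
  ring

/-- The values of a quadratic form in coordinates. -/
theorem betaQ_sum (q : G.Q) {m : ℕ} (e : Fin m → G.V) (y : Fin m → G.K) :
    G.betaQ q (∑ i, y i • e i) = ∑ i, y i ^ 2 * G.betaQ q (e i) +
      ∑ i, ∑ j, if i < j then y i * y j * G.betaV (e i) (e j) else 0 := by
  induction m with
  | zero => simp [betaQ_zero]
  | succ m ih =>
    rw [Fin.sum_univ_succ, betaQ_add, betaQ_smul, ih (fun i => e i.succ) (fun i => y i.succ)]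
    simp only [Fin.sum_univ_succ, Fin.succ_lt_succ_iff, Fin.succ_pos, if_true, if_false,
      Fin.not_lt_zero, map_sum, map_smul, LinearMap.smul_apply, smul_eq_mul, zero_add,
      mul_assoc, mul_left_comm (y 0)]
    ring

theorem addQ_eq_iff {q q' : G.Q} {v : G.V} : G.addQ q v = q' ↔ v = G.subQ q' q :=
  ⟨fun h => (G.addQ_regular q q').unique h (G.addQ_subQ q' q), fun h => h ▸ G.addQ_subQ q' q⟩

theorem addQ_injective (q : G.Q) : Function.Injective (G.addQ q) := fun _ _ h =>
  (G.addQ_eq_iff.1 h).trans (G.addQ_eq_iff.1 rfl).symm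

theorem addQ_surjective (q : G.Q) : Function.Surjective (G.addQ q) := fun q' =>
  ⟨_, G.addQ_subQ q' q⟩

theorem subQ_addQ (q : G.Q) (v w : G.V) :
    G.subQ (G.addQ q v) (G.addQ q w) = v - w := by
  symm
  rw [← G.addQ_eq_iff, ← G.addQ_add, add_sub_cancel]

/-- Prescribed values of the bilinear form at independent vectors are attained. -/
theorem exists_betaV_eq {ι : Type*} [Fintype ι] {e : ι → G.V} (he : LinearIndependent G.K e)
    (b : ι → G.K) : ∃ x, ∀ i, G.betaV (e i) x = b i := by
  classical
  let f : G.V →ₗ[G.K] (ι → G.K) := LinearMap.pi fun i => G.betaV (e i)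
  have hf : LinearMap.range f = ⊤ := by
    by_contra hne
    obtain ⟨φ, hφ, hle⟩ := Submodule.exists_le_ker_of_lt_top _ (lt_top_iff_ne_top.2 hne)
    have h0 : ∑ i, φ (Pi.single i 1) • e i = 0 := by
      refine G.betaV_nondegenerate _ fun x => ?_
      have h1 : φ (f x) = 0 := hle ⟨x, rfl⟩
      rw [LinearMap.pi_apply_eq_sum_univ φ (f x)] at h1
      rw [map_sum, LinearMap.sum_apply, ← h1]
      refine Finset.sum_congr rfl fun i _ => ?_
      rw [map_smul, LinearMap.smul_apply, smul_eq_mul, smul_eq_mul, mul_comm]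
      congr 2
      ext j
      simp [Pi.single_apply, eq_comm]
    have h2 := Fintype.linearIndependent_iff.1 he _ h0
    refine hφ (LinearMap.ext fun y => ?_)
    rw [LinearMap.pi_apply_eq_sum_univ φ y]
    refine Finset.sum_eq_zero fun i _ => ?_
    have h3 : (fun j => if i = j then (1 : G.K) else 0) = Pi.single i 1 := by
      ext j
      simp [Pi.single_apply, eq_comm]
    rw [h3, h2 i, smul_zero]
  obtain ⟨x, hx⟩ := LinearMap.range_eq_top.1 hf b
  exact ⟨x, fun i => congrFun hx i⟩

/-- In large dimension, the orthogonal complement of `m` vectors is not contained in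
their span. -/
theorem exists_orthogonal_notMem_span {m : ℕ} (e : Fin m → G.V) {N : ℕ} (hN : 2 * m < N)
    {f : Fin N → G.V} (hf : LinearIndependent G.K f) :
    ∃ y, y ∉ Submodule.span G.K (Set.range e) ∧ ∀ i, G.betaV (e i) y = 0 := by
  by_contra! hcon
  let U := Submodule.span G.K (Set.range f)
  have : Module.Finite G.K U := Module.Finite.span_of_finite G.K (Set.finite_range f)
  have : Module.Finite G.K (Submodule.span G.K (Set.range e)) :=
    Module.Finite.span_of_finite G.K (Set.finite_range e)
  let g : U →ₗ[G.K] (Fin m → G.K) := (LinearMap.pi fun i => G.betaV (e i)).comp U.subtype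
  have hU : Module.finrank G.K U = N := by
    simpa using finrank_span_eq_card hf
  have h1 := LinearMap.finrank_range_add_finrank_ker g
  have h2 : Module.finrank G.K (LinearMap.range g) ≤ m := by
    simpa using Submodule.finrank_le (LinearMap.range g)
  have h3 : (LinearMap.ker g).map U.subtype ≤ Submodule.span G.K (Set.range e) := by
    rintro _ ⟨y, hy, rfl⟩
    by_contra hy'
    obtain ⟨i, hi⟩ := hcon _ hy'
    exact hi (congrFun (LinearMap.mem_ker.1 hy) i)
  have h4 : Module.finrank G.K ((LinearMap.ker g).map U.subtype) =
      Module.finrank G.K (LinearMap.ker g) :=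
    (Submodule.equivMapOfInjective U.subtype U.subtype_injective _).finrank_eq.symm
  have h5 := Submodule.finrank_mono h3
  have h6 : Module.finrank G.K (Submodule.span G.K (Set.range e)) ≤ m := by
    simpa [Set.finrank] using finrank_range_le_card (R := G.K) e
  omega

/-- The extension property in large dimension: over a perfect field there is a new vector with
prescribed values of the bilinear form and of the quadratic form. -/
theorem exists_extension (hK : ∀ a : G.K, ∃ b, b ^ 2 = a) (q : G.Q) {m : ℕ} {e : Fin m → G.V}
    (he : LinearIndependent G.K e) {N : ℕ} (hN : 2 * m + 3 ≤ N) {f : Fin N → G.V}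
    (hf : LinearIndependent G.K f) (b : Fin m → G.K) (a : G.K) :
    ∃ x, x ∉ Submodule.span G.K (Set.range e) ∧ (∀ i, G.betaV (e i) x = b i) ∧
      G.betaQ q x = a := by
  obtain ⟨x, hx, hxb⟩ : ∃ x, x ∉ Submodule.span G.K (Set.range e) ∧
      ∀ i, G.betaV (e i) x = b i := by
    obtain ⟨x, hx⟩ := G.exists_betaV_eq he b
    by_cases hxe : x ∈ Submodule.span G.K (Set.range e)
    · obtain ⟨y, hy, hye⟩ := G.exists_orthogonal_notMem_span e (by omega) hf
      exact ⟨x + y, fun h => hy (by simpa using Submodule.sub_mem _ h hxe), fun i => by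
        rw [map_add, hx, hye, add_zero]⟩
    · exact ⟨x, hxe, hx⟩
  have he' : LinearIndependent G.K (Fin.cons x e : Fin (m + 1) → G.V) :=
    he.finCons hx
  obtain ⟨y, hy, hye⟩ := G.exists_orthogonal_notMem_span (Fin.cons x e : Fin (m + 1) → G.V)
    (by omega) hf
  obtain ⟨z, hz⟩ := G.exists_betaV_eq (he'.finCons hy) (Fin.cons 1 0)
  have hyz : G.betaV y z = 1 := by simpa using hz 0
  have hz' : ∀ i, G.betaV ((Fin.cons x e : Fin (m + 1) → G.V) i) z = 0 := fun i => by
    simpa using hz i.succ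
  -- the quadratic form does not vanish on the plane spanned by `y` and `z`
  obtain ⟨t, t', ht, htt, ht0⟩ : ∃ t t' : G.V,
      (∀ i, G.betaV ((Fin.cons x e : Fin (m + 1) → G.V) i) t = 0 ∧
        G.betaV ((Fin.cons x e : Fin (m + 1) → G.V) i) t' = 0) ∧
      G.betaV t t' = 1 ∧ G.betaQ q t ≠ 0 := by
    by_cases h1 : G.betaQ q y = 0
    · by_cases h2 : G.betaQ q z = 0
      · refine ⟨y + z, z, fun i => ⟨by rw [map_add, hye, hz', add_zero], hz' i⟩, ?_, ?_⟩
        · rw [map_add, LinearMap.add_apply, hyz, G.betaV_alternating, add_zero]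
        · simp [betaQ_add, h1, h2, hyz]
      · exact ⟨z, y, fun i => ⟨hz' i, hye i⟩, by rw [betaV_comm, hyz], h2⟩
    · exact ⟨y, z, fun i => ⟨hye i, hz' i⟩, hyz, h1⟩
  obtain ⟨s, hs⟩ := hK ((a - G.betaQ q x) / G.betaQ q t)
  have hxt : G.betaV x t = 0 := by simpa using (ht 0).1
  have hxt' : G.betaV x t' = 0 := by simpa using (ht 0).2
  refine ⟨x + s • t, fun hmem => ?_, fun i => ?_, ?_⟩
  · have hperp : ∀ v ∈ Submodule.span G.K (Set.range e), G.betaV v t' = 0 := by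
      intro v hv
      induction hv using Submodule.span_induction with
      | mem v hv =>
        obtain ⟨i, rfl⟩ := hv
        simpa using (ht i.succ).2
      | zero => simp
      | add v w _ _ hv hw => rw [map_add, LinearMap.add_apply, hv, hw, add_zero]
      | smul c v _ hv => rw [map_smul, LinearMap.smul_apply, hv, smul_zero]
    have h1 := hperp _ hmem
    rw [map_add, map_smul, LinearMap.add_apply, LinearMap.smul_apply, hxt', htt, zero_add,
      smul_eq_mul, mul_one] at h1
    rw [h1, zero_smul, add_zero] at hmem
    exact hx hmem
  · have h1 : G.betaV (e i) t = 0 := by simpa using (ht i.succ).1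
    rw [map_add, map_smul, hxb, h1, smul_zero, add_zero]
  · rw [betaQ_add, betaQ_smul, hs, map_smul, hxt, smul_zero, div_mul_cancel₀ _ ht0]
    ring

/-- A symplectic family: the vector `b i` is paired with `b i.swap`, and orthogonal to all
other members. -/
def IsSymplectic {n : ℕ} (b : Fin n ⊕ Fin n → G.V) : Prop :=
  ∀ i j, G.betaV (b i) (b j) = if j = i.swap then 1 else 0

variable {G}

theorem IsSymplectic.betaV_sum {n : ℕ} {b : Fin n ⊕ Fin n → G.V} (hb : G.IsSymplectic b)
    (c : Fin n ⊕ Fin n → G.K) (j : Fin n ⊕ Fin n) :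
    G.betaV (∑ i, c i • b i) (b j) = c j.swap := by
  rw [map_sum, LinearMap.sum_apply, Finset.sum_eq_single j.swap]
  · simp [hb _ _]
  · intro i _ hi
    have : j ≠ i.swap := fun h => hi (by simp [h])
    simp [hb _ _, this]
  · simp

theorem IsSymplectic.linearIndependent {n : ℕ} {b : Fin n ⊕ Fin n → G.V}
    (hb : G.IsSymplectic b) : LinearIndependent G.K b := by
  refine Fintype.linearIndependent_iff.2 fun c hc i => ?_
  have h := hb.betaV_sum c i.swap
  rw [hc] at h
  simpa using h.symm

theorem isHyperbolic_iff {q : G.Q} : G.IsHyperbolic q ↔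
    ∃ (n : ℕ) (b : Fin n ⊕ Fin n → G.V), G.IsSymplectic b ∧
      Submodule.span G.K (Set.range b) = ⊤ ∧ ∀ i, G.betaQ q (b i) = 0 := by
  constructor
  · rintro ⟨n, b, hq, h1, h2, h3⟩
    refine ⟨n, b, ?_, b.span_eq, hq⟩
    rintro (i | i) (j | j)
    · simp [h2]
    · simp [h1, eq_comm]
    · rw [betaV_comm, h1]
      simp
    · simp [h3]
  · rintro ⟨n, b, hb, hs, hq⟩
    refine ⟨n, Module.Basis.mk hb.linearIndependent hs.ge, by simpa using hq, fun i j => ?_,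
      fun i j => ?_, fun i j => ?_⟩ <;> simp [hb _ _, eq_comm]

/-- A symplectic family that does not span can be extended by a hyperbolic pair. -/
theorem IsSymplectic.exists_succ {n : ℕ} {b : Fin n ⊕ Fin n → G.V} (hb : G.IsSymplectic b)
    (hs : Submodule.span G.K (Set.range b) ≠ ⊤) :
    ∃ b' : Fin (n + 1) ⊕ Fin (n + 1) → G.V, G.IsSymplectic b' := by
  -- subtraction of the projection to the span of the family
  obtain ⟨p, hp_def⟩ : ∃ p : G.V → G.V, ∀ x, p x = x - ∑ i, G.betaV x (b i.swap) • b i :=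
    ⟨_, fun _ => rfl⟩
  have hp : ∀ x j, G.betaV (p x) (b j) = 0 := fun x j => by
    rw [hp_def, map_sub, LinearMap.sub_apply, hb.betaV_sum, Sum.swap_swap, sub_self]
  obtain ⟨x, -, hx⟩ := SetLike.exists_of_lt (lt_top_iff_ne_top.2 hs)
  have hx0 : p x ≠ 0 := fun h => hx (by
    rw [sub_eq_zero.1 ((hp_def x).symm.trans h)]
    exact Submodule.sum_mem _ fun i _ =>
      Submodule.smul_mem _ _ (Submodule.subset_span ⟨i, rfl⟩))
  obtain ⟨z, hz⟩ : ∃ z, G.betaV (p x) z ≠ 0 := by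
    by_contra! h
    exact hx0 (G.betaV_nondegenerate _ h)
  obtain ⟨y, hxy, hy⟩ : ∃ y, G.betaV (p x) y = 1 ∧ ∀ j, G.betaV y (b j) = 0 := by
    refine ⟨p ((G.betaV (p x) z)⁻¹ • z), ?_, hp _⟩
    rw [hp_def ((G.betaV (p x) z)⁻¹ • z), map_sub, map_sum, map_smul, smul_eq_mul,
      inv_mul_cancel₀ hz, Finset.sum_eq_zero, sub_zero]
    exact fun i _ => by rw [map_smul, hp, smul_zero]
  refine ⟨Sum.elim (Fin.cons (p x) fun i => b (.inl i)) (Fin.cons y fun i => b (.inr i)), ?_⟩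
  have hx' : ∀ j, G.betaV (b j) (p x) = 0 := fun j => by rw [betaV_comm, hp]
  have hy' : ∀ j, G.betaV (b j) y = 0 := fun j => by rw [betaV_comm, hy]
  rintro (i | i) (j | j) <;> cases i using Fin.cases <;> cases j using Fin.cases <;>
    simp [hb _ _, hp, hy, hx', hy', hxy, G.betaV_alternating, G.betaV_comm y, Fin.succ_ne_zero,
      (Fin.succ_ne_zero _).symm]

variable (G) in
theorem exists_symplectic_basis [Module.Finite G.K G.V] :
    ∃ (n : ℕ) (b : Fin n ⊕ Fin n → G.V), G.IsSymplectic b ∧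
      Submodule.span G.K (Set.range b) = ⊤ := by
  -- otherwise symplectic families can be extended indefinitely
  by_contra! hcon
  have h : ∀ n, ∃ b : Fin n ⊕ Fin n → G.V, G.IsSymplectic b := by
    intro n
    induction n with
    | zero => exact ⟨fun i => i.elim Fin.elim0 Fin.elim0, fun i => i.elim Fin.elim0 Fin.elim0⟩
    | succ n ih =>
      obtain ⟨b, hb⟩ := ih
      exact hb.exists_succ (hcon n b hb)
  obtain ⟨b, hb⟩ := h (Module.finrank G.K G.V + 1)
  have := hb.linearIndependent.fintype_card_le_finrank
  simp at this
  omega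

theorem IsSymplectic.finrank_eq {n : ℕ} {b : Fin n ⊕ Fin n → G.V} (hb : G.IsSymplectic b)
    (hs : Submodule.span G.K (Set.range b) = ⊤) : Module.finrank G.K G.V = 2 * n := by
  rw [Module.finrank_eq_card_basis (Module.Basis.mk hb.linearIndependent hs.ge)]
  simp [two_mul]

/-- Over a perfect field, `Q` contains a form that vanishes on a given finite independent
family. -/
theorem exists_betaQ_eq_zero (hK : ∀ a : G.K, ∃ b, b ^ 2 = a) (q : G.Q) {ι : Type*} [Fintype ι]
    {e : ι → G.V} (he : LinearIndependent G.K e) : ∃ q' : G.Q, ∀ i, G.betaQ q' (e i) = 0 := by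
  choose r hr using hK
  obtain ⟨v, hv⟩ := G.exists_betaV_eq he fun i => r (G.betaQ q (e i))
  exact ⟨G.addQ q v, fun i => by
    rw [G.betaQ_addQ, betaV_comm, hv, hr, CharTwo.add_self_eq_zero]⟩

end QuadraticGeometry

/-! ### The Arf invariant -/

namespace QuadraticGeometry

variable {G : QuadraticGeometry.{u}}

/-- Half of a symplectic basis spans a subspace that contains its orthogonal complement. -/
theorem mem_span_inl_of_orthogonal {n : ℕ} {b : Fin n ⊕ Fin n → G.V} (hb : G.IsSymplectic b)
    (hs : Submodule.span G.K (Set.range b) = ⊤) {x : G.V}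
    (hx : ∀ i, G.betaV x (b (.inl i)) = 0) :
    x ∈ Submodule.span G.K (Set.range fun i => b (.inl i)) := by
  obtain ⟨c, rfl⟩ := (Submodule.mem_span_range_iff_exists_fun G.K).1
    (hs ▸ Submodule.mem_top : x ∈ Submodule.span G.K (Set.range b))
  simp only [hb.betaV_sum, Sum.swap_inl] at hx
  rw [Fintype.sum_sum_type]
  simp only [hx, zero_smul, Finset.sum_const_zero, add_zero]
  exact Submodule.sum_mem _ fun i _ => Submodule.smul_mem _ _ (Submodule.subset_span ⟨i, rfl⟩)

theorem betaQ_eq_zero_of_mem_span_inl {q : G.Q} {n : ℕ} {b : Fin n ⊕ Fin n → G.V}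
    (hb : G.IsSymplectic b) (hq : ∀ i, G.betaQ q (b i) = 0) {x : G.V}
    (hx : x ∈ Submodule.span G.K (Set.range fun i => b (.inl i))) : G.betaQ q x = 0 := by
  obtain ⟨c, rfl⟩ := (Submodule.mem_span_range_iff_exists_fun G.K).1 hx
  simp [betaQ_sum, hq, hb _ _]

/-- A hyperbolic form has a Lagrangian: a subspace on which it vanishes and that is its own
orthogonal complement. -/
theorem IsHyperbolic.exists_lagrangian {q : G.Q} (h : G.IsHyperbolic q) :
    ∃ U : Submodule G.K G.V, (∀ x ∈ U, G.betaQ q x = 0) ∧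
      ∀ x, x ∈ U ↔ ∀ y ∈ U, G.betaV x y = 0 := by
  obtain ⟨n, b, hb, hs, hq⟩ := isHyperbolic_iff.1 h
  refine ⟨Submodule.span G.K (Set.range fun i => b (.inl i)),
    fun x hx => betaQ_eq_zero_of_mem_span_inl hb hq hx, fun x => ⟨fun hx y hy => ?_, fun hx =>
      mem_span_inl_of_orthogonal hb hs fun i => hx _ (Submodule.subset_span ⟨i, rfl⟩)⟩⟩
  have hz : ∀ z ∈ Submodule.span G.K (Set.range fun i => b (.inl i)), G.betaQ q z = 0 :=
    fun z hz => betaQ_eq_zero_of_mem_span_inl hb hq hz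
  rw [G.betaV_eq q, hz _ (Submodule.add_mem _ hx hy), hz _ hx, hz _ hy]
  simp

theorem IsHyperbolic.finite {q : G.Q} (h : G.IsHyperbolic q) : Module.Finite G.K G.V := by
  obtain ⟨n, b, -⟩ := h
  exact Module.Finite.of_basis b

/-- A subspace of a finite-dimensional geometry contains every vector orthogonal to its
orthogonal complement. -/
theorem mem_of_orthogonal [Module.Finite G.K G.V] (U : Submodule G.K G.V) {v : G.V}
    (hv : ∀ x, (∀ y ∈ U, G.betaV x y = 0) → G.betaV x v = 0) : v ∈ U := by
  by_contra hvU
  obtain ⟨φ, hφ, hle⟩ := Submodule.exists_le_ker_of_notMem hvU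
  obtain ⟨n, b, hb, hs⟩ := G.exists_symplectic_basis
  obtain ⟨x, hx⟩ := G.exists_betaV_eq hb.linearIndependent fun i => φ (b i)
  have h : G.betaV x = φ := by
    refine LinearMap.ext_on_range hs fun i => ?_
    rw [betaV_comm, hx]
  refine hφ ?_
  rw [← h]
  exact hv x fun y hy => by
    rw [h]
    exact hle hy

/-- If both `q` and its translate by `v` are hyperbolic, then `q v` has the form `x² - x`. For
Lagrangians `U` of `q` and `W` of the translate, `q = β(v, ·)²` on `W`; so `v` is orthogonal to
`U ⊓ W`, and hence `v = u + w` with `u ∈ U` and `w ∈ W`. -/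
theorem IsHyperbolic.exists_betaQ_eq {q : G.Q} {v : G.V} (h : G.IsHyperbolic q)
    (h' : G.IsHyperbolic (G.addQ q v)) : ∃ x : G.K, G.betaQ q v = x ^ 2 - x := by
  have := h.finite
  obtain ⟨U, hU, hU'⟩ := h.exists_lagrangian
  obtain ⟨W, hW, hW'⟩ := h'.exists_lagrangian
  have hv : v ∈ U ⊔ W := by
    refine mem_of_orthogonal _ fun x hx => ?_
    have h1 : G.betaQ q x = 0 := hU x ((hU' x).2 fun y hy => hx y (Submodule.mem_sup_left hy))
    have h2 := hW x ((hW' x).2 fun y hy => hx y (Submodule.mem_sup_right hy))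
    rw [G.betaQ_addQ, h1, zero_add] at h2
    rw [betaV_comm]
    exact pow_eq_zero_iff two_ne_zero |>.1 h2
  obtain ⟨u, hu, w, hw, rfl⟩ := Submodule.mem_sup.1 hv
  have h3 := hW w hw
  rw [G.betaQ_addQ, map_add, LinearMap.add_apply, G.betaV_alternating, add_zero,
    CharTwo.add_eq_zero] at h3
  refine ⟨G.betaV u w, ?_⟩
  rw [betaQ_add, hU u hu, h3, CharTwo.sub_eq_add, zero_add]

/-- If `q` is hyperbolic and `q v` has the form `x² - x`, then the translate of `q` by `v` is
hyperbolic: it is isometric to `q` by a transvection along `v`. -/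
theorem IsHyperbolic.addQ {q : G.Q} {v : G.V} (h : G.IsHyperbolic q)
    (hv : ∃ x : G.K, G.betaQ q v = x ^ 2 - x) : G.IsHyperbolic (G.addQ q v) := by
  obtain ⟨n, b, hb, hs, hq⟩ := isHyperbolic_iff.1 h
  -- the coefficient for which the transvection `x ↦ x + s β(v, x) v` is the required isometry
  obtain ⟨s, hsv⟩ : ∃ s : G.K, s + s ^ 2 * G.betaQ q v = 1 := by
    obtain ⟨x, hx⟩ := hv
    by_cases h0 : G.betaQ q v = 0
    · exact ⟨1, by simp [h0]⟩
    · refine ⟨x / G.betaQ q v, ?_⟩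
      field_simp
      rw [hx, CharTwo.sub_eq_add]
      ring
  let t : G.V → G.V := fun x => x + (s * G.betaV v x) • v
  have ht : ∀ x y, G.betaV (t x) (t y) = G.betaV x y := fun x y => by
    simp only [t, map_add, LinearMap.add_apply, map_smul, LinearMap.smul_apply, smul_eq_mul,
      G.betaV_alternating, G.betaV_comm x v]
    linear_combination (s * G.betaV v x * G.betaV v y) * CharTwo.two_eq_zero (R := G.K)
  have htq : ∀ x, G.betaQ (G.addQ q v) (t x) = G.betaQ q x := fun x => by
    have h1 : G.betaV v (t x) = G.betaV v x := by
      simp [t, G.betaV_alternating]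
    rw [G.betaQ_addQ, h1]
    simp only [t, betaQ_add, G.betaQ_smul, map_smul, smul_eq_mul, G.betaV_comm x v]
    linear_combination (G.betaV v x) ^ 2 * hsv +
      (G.betaV v x) ^ 2 * CharTwo.two_eq_zero (R := G.K)
  have hb' : G.IsSymplectic fun i => t (b i) := fun i j => by rw [ht, hb]
  have := h.finite
  refine isHyperbolic_iff.2 ⟨n, fun i => t (b i), hb', ?_, fun i => by rw [htq, hq]⟩
  exact hb'.linearIndependent.span_eq_top_of_card_eq_finrank' (by
    rw [hb.finrank_eq hs]
    simp [two_mul])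

end QuadraticGeometry

/-! ### Artin–Schreier classes -/

/-- The element `a` has the form `x² - x`. -/
def IsArtinSchreier {K : Type*} [Field K] (a : K) : Prop := ∃ x : K, a = x ^ 2 - x

/-- The properties of finite fields of characteristic `2` that are used below: every element is
a square, and the elements of the form `x² - x` are a subgroup of index `2`. -/
structure IsArtinSchreierField (K : Type*) [Field K] : Prop where
  exists_sq : ∀ a : K, ∃ b, b ^ 2 = a
  exists_not : ∃ a : K, ¬ IsArtinSchreier a
  add_of_not : ∀ a b : K, ¬ IsArtinSchreier a → ¬ IsArtinSchreier b → IsArtinSchreier (a + b)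

theorem IsArtinSchreier.add {K : Type*} [Field K] [CharP K 2] {a b : K}
    (ha : IsArtinSchreier a) (hb : IsArtinSchreier b) : IsArtinSchreier (a + b) := by
  obtain ⟨x, rfl⟩ := ha
  obtain ⟨y, rfl⟩ := hb
  exact ⟨x + y, by rw [CharTwo.add_sq]; ring⟩

theorem isArtinSchreier_add_iff {K : Type*} [Field K] [CharP K 2]
    (hK : IsArtinSchreierField K) (a b : K) :
    IsArtinSchreier (a + b) ↔ (IsArtinSchreier a ↔ IsArtinSchreier b) := by
  have h1 : a + b + b = a := by rw [add_assoc, CharTwo.add_self_eq_zero, add_zero]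
  have h2 : a + b + a = b := by rw [add_comm, ← add_assoc, CharTwo.add_self_eq_zero, zero_add]
  constructor
  · exact fun h => ⟨fun ha => h2 ▸ h.add ha, fun hb => h1 ▸ h.add hb⟩
  · intro h
    by_cases ha : IsArtinSchreier a
    · exact ha.add (h.1 ha)
    · exact hK.add_of_not a b ha (mt h.2 ha)

theorem isArtinSchreierField_of_finite (K : Type*) [Field K] [Finite K] [CharP K 2] :
    IsArtinSchreierField K := by
  have := Fintype.ofFinite K
  -- an additive map with kernel `{0, 1}`, so that its range has index `2`
  let f : K →+ K :=
    { toFun := fun x => x ^ 2 - x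
      map_zero' := by simp
      map_add' := fun x y => by rw [CharTwo.add_sq]; ring }
  have hf : ∀ a, IsArtinSchreier a ↔ a ∈ f.range := fun a =>
    ⟨fun ⟨x, hx⟩ => ⟨x, hx.symm⟩, fun ⟨x, hx⟩ => ⟨x, hx.symm⟩⟩
  have hker : Nat.card f.ker = 2 := by
    have : (f.ker : Set K) = {0, 1} := by
      ext x
      have : f x = x * (x - 1) := by simp only [f, AddMonoidHom.coe_mk, ZeroHom.coe_mk]; ring
      simp [this, sub_eq_zero]
    rw [← SetLike.coe_sort_coe, this, Nat.card_coe_set_eq, Set.ncard_pair zero_ne_one]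
  have hindex : f.range.index = 2 := by
    have h1 := f.range.card_mul_index
    have h2 := f.ker.card_mul_index
    rw [AddSubgroup.index_ker, hker] at h2
    have h3 : 0 < Nat.card f.range := Nat.card_pos
    rw [← h2, mul_comm] at h1
    exact Nat.eq_of_mul_eq_mul_right h3 h1
  refine ⟨fun a => ?_, ?_, fun a b ha hb => ?_⟩
  · obtain ⟨b, hb⟩ := FiniteField.isSquare_of_char_two (CharP.eq K (ringChar.charP K) ‹_›) a
    exact ⟨b, by rw [hb, pow_two]⟩
  · by_contra! h
    have : f.range = ⊤ := eq_top_iff.2 fun a _ => (hf a).1 (h a)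
    rw [this, AddSubgroup.index_top] at hindex
    omega
  · rw [hf] at *
    rw [AddSubgroup.add_mem_iff_of_index_two hindex]
    tauto

open Classical in
/-- The Artin–Schreier class of a field element, as one of the field elements `0` and `1`. -/
noncomputable def artinSchreierClass {K : Type*} [Field K] (a : K) : K :=
  if IsArtinSchreier a then 0 else 1

theorem artinSchreierClass_eq_iff {K : Type*} [Field K] {a b : K} :
    artinSchreierClass a = artinSchreierClass b ↔ (IsArtinSchreier a ↔ IsArtinSchreier b) := by
  unfold artinSchreierClass
  by_cases ha : IsArtinSchreier a <;> by_cases hb : IsArtinSchreier b <;> simp [ha, hb]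

theorem artinSchreierClass_eq_zero_iff {K : Type*} [Field K] {a : K} :
    artinSchreierClass a = 0 ↔ IsArtinSchreier a := by
  simp [artinSchreierClass]

/-! ### Standard models -/

section Standard

variable (K : Type u) [Field K] (I : Type)

/-- The standard pairing on the finitely supported functions. -/
noncomputable def dot : (I →₀ K) →ₗ[K] (I →₀ K) →ₗ[K] K :=
  Finsupp.lsum K fun i => LinearMap.toSpanSingleton K _ (Finsupp.lapply i)

variable {K I}

@[simp]
theorem dot_single_left (i : I) (a : K) (y : I →₀ K) :
    dot K I (Finsupp.single i a) y = a * y i := by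
  simp [dot]

@[simp]
theorem dot_single_right (x : I →₀ K) (i : I) (a : K) :
    dot K I x (Finsupp.single i a) = x i * a := by
  classical
  induction x using Finsupp.induction_linear with
  | zero => simp
  | add x y hx hy => simp [hx, hy, add_mul]
  | single j b => simp [Finsupp.single_apply, eq_comm]

variable (K I) in
/-- The standard geometry: `V` has the coordinates `x_i, y_i` for `i ∈ I`, the elements of `Q` are
the translates of the form `∑ x_i y_i`, and `Q` is identified with `V`. -/
noncomputable def standard [CharP K 2] : QuadraticGeometry.{u} where
  K := K
  V := (I →₀ K) × (I →₀ K)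
  Q := (I →₀ K) × (I →₀ K)
  charTwo := inferInstance
  betaV := LinearMap.mk₂ K (fun v w => dot K I v.1 w.2 + dot K I w.1 v.2)
    (fun v v' w => by simp; ring) (fun c v w => by simp; ring)
    (fun v w w' => by simp; ring) (fun c v w => by simp; ring)
  betaV_alternating v := by simp [CharTwo.add_self_eq_zero]
  betaV_nondegenerate v hv := by
    ext i
    · simpa using hv (0, Finsupp.single i 1)
    · simpa using hv (Finsupp.single i 1, 0)
  betaQ q w := dot K I w.1 w.2 + (dot K I q.1 w.2 + dot K I w.1 q.2) ^ 2
  betaQ_smul q a w := by simp; ring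
  betaV_eq q v w := by
    simp only [LinearMap.mk₂_apply, Prod.fst_add, Prod.snd_add, map_add, LinearMap.add_apply]
    linear_combination (- (dot K I q.1 v.2 + dot K I v.1 q.2) *
      (dot K I q.1 w.2 + dot K I w.1 q.2)) * CharTwo.two_eq_zero (R := K)
  addQ q v := q + v
  addQ_zero q := add_zero q
  addQ_add q v w := (add_assoc q v w).symm
  addQ_regular q q' := ⟨q' - q, add_sub_cancel q q', fun v hv => eq_sub_of_add_eq' hv⟩
  betaQ_addQ q v w := by
    simp only [LinearMap.mk₂_apply, Prod.fst_add, Prod.snd_add, map_add, LinearMap.add_apply]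
    linear_combination ((dot K I q.1 w.2 + dot K I w.1 q.2) *
      (dot K I v.1 w.2 + dot K I w.1 v.2)) * CharTwo.two_eq_zero (R := K)
  subQ q q' := q - q'
  addQ_subQ q q' := add_sub_cancel q' q

variable [CharP K 2]

/-- The standard symplectic family indexed by some of the coordinates. -/
theorem exists_isSymplectic_standard {n : ℕ} (f : Fin n ↪ I) :
    ∃ b, (standard K I).IsSymplectic b ∧
      ∀ i : Fin n ⊕ Fin n, (standard K I).betaQ (0 : (I →₀ K) × (I →₀ K)) (b i) = 0 := by
  classical
  let b : Fin n ⊕ Fin n → (I →₀ K) × (I →₀ K) :=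
    Sum.elim (fun i => (Finsupp.single (f i) 1, 0)) fun i => (0, Finsupp.single (f i) 1)
  have hb : ∀ i j, dot K I (b i).1 (b j).2 + dot K I (b j).1 (b i).2 =
      if j = i.swap then 1 else 0 := by
    rintro (i | i) (j | j) <;> simp [b, Finsupp.single_apply, eq_comm]
  have hq : ∀ i, dot K I (b i).1 (b i).2 + (dot K I 0 (b i).2 + dot K I (b i).1 0) ^ 2 = 0 := by
    rintro (i | i) <;> simp [b]
  exact ⟨b, hb, hq⟩

theorem isHyperbolic_standard [Finite I] :
    (standard K I).IsHyperbolic (0 : (I →₀ K) × (I →₀ K)) := by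
  have := Fintype.ofFinite I
  obtain ⟨b, hb, hq⟩ := exists_isSymplectic_standard (K := K)
    (Fintype.equivFin I).symm.toEmbedding
  have hfin : Module.Finite (standard K I).K (standard K I).V :=
    inferInstanceAs (Module.Finite K ((I →₀ K) × (I →₀ K)))
  refine QuadraticGeometry.isHyperbolic_iff.2 ⟨_, b, hb, ?_, hq⟩
  refine hb.linearIndependent.span_eq_top_of_card_eq_finrank' ?_
  change _ = Module.finrank K ((I →₀ K) × (I →₀ K))
  simp

theorem finrank_standard [Fintype I] :
    Module.finrank (standard K I).K (standard K I).V = 2 * Fintype.card I := by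
  change Module.finrank K ((I →₀ K) × (I →₀ K)) = _
  simp [two_mul]

theorem finite_of_finite_standard
    (h : Module.Finite (standard K I).K (standard K I).V) : Finite I := by
  have h : Module.Finite K ((I →₀ K) × (I →₀ K)) := h
  have : Module.Finite K (I →₀ K) :=
    Module.Finite.of_surjective (LinearMap.fst K (I →₀ K) (I →₀ K)) Prod.fst_surjective
  exact Module.Finite.finite_basis (Finsupp.basisSingleOne (R := K) (ι := I))

variable (K I) in
/-- The Witt defect of the standard geometry: the Artin–Schreier class of the value of the
standard form at the translating vector. -/
noncomputable def standardDefect (q : (standard K I).Q) : (standard K I).K :=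
  artinSchreierClass (dot K I q.1 q.2)

theorem artinSchreierClass_dot_eq_iff (hK : IsArtinSchreierField K)
    (v w : (I →₀ K) × (I →₀ K)) :
    artinSchreierClass (dot K I v.1 v.2) = artinSchreierClass (dot K I w.1 w.2) ↔
      IsArtinSchreier (dot K I (v.1 - w.1) (v.2 - w.2) +
        (dot K I v.1 (v.2 - w.2) + dot K I (v.1 - w.1) v.2) ^ 2) := by
  have h : dot K I (v.1 - w.1) (v.2 - w.2) +
      (dot K I v.1 (v.2 - w.2) + dot K I (v.1 - w.1) v.2) ^ 2 =
      dot K I v.1 v.2 + dot K I w.1 w.2 + ((dot K I v.1 w.2 + dot K I w.1 v.2) ^ 2 -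
        (dot K I v.1 w.2 + dot K I w.1 v.2)) := by
    simp only [map_sub, LinearMap.sub_apply]
    linear_combination (2 * (dot K I v.1 v.2) ^ 2 - 2 * dot K I v.1 v.2 *
      (dot K I v.1 w.2 + dot K I w.1 v.2)) * CharTwo.two_eq_zero (R := K)
  rw [h, artinSchreierClass_eq_iff, isArtinSchreier_add_iff hK (_ + _) (_ - _),
    isArtinSchreier_add_iff hK]
  exact (iff_true_right ⟨_, rfl⟩).symm

theorem isWittDefect_standard (hK : IsArtinSchreierField K) :
    (standard K I).IsWittDefect (standardDefect K I) where
  zero_or_one q := by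
    by_cases h : IsArtinSchreier (dot K I q.1 q.2)
    · exact .inl (if_pos h)
    · exact .inr (if_neg h)
  eq_iff q₁ q₂ :=
    artinSchreierClass_dot_eq_iff hK q₁ q₂
  eq_zero_iff n hfin _ q := by
    have := finite_of_finite_standard hfin
    have h1 : (standard K I).addQ (0 : (I →₀ K) × (I →₀ K)) q = q :=
      zero_add (M := (I →₀ K) × (I →₀ K)) q
    have h2 : (standard K I).betaQ (0 : (I →₀ K) × (I →₀ K)) q = dot K I q.1 q.2 := by
      change dot K I q.1 q.2 + (dot K I 0 q.2 + dot K I q.1 0) ^ 2 = _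
      simp
    refine artinSchreierClass_eq_zero_iff.trans ?_
    rw [← h2]
    refine ⟨fun h => h1 ▸ isHyperbolic_standard.addQ h, fun h => ?_⟩
    exact isHyperbolic_standard.exists_betaQ_eq (h1.symm ▸ h)

end Standard

open ManySorted

/-! ### Definability of terms -/

/-- The index type for the coordinates of an element of a given sort, in a geometry with `m`
chosen vectors. -/
def Coord (m : ℕ) : Srt → Type
  | .K => Unit
  | .V => Fin m
  | .Q => Fin m

instance (m : ℕ) : ∀ s, Finite (Coord m s)
  | .K => inferInstanceAs (Finite Unit)
  | .V => inferInstanceAs (Finite (Fin m))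
  | .Q => inferInstanceAs (Finite (Fin m))

/-- The index type for the values `β(e_i, e_j)` and `q(e_i)`. -/
abbrev GramIndex (m : ℕ) : Type := (Fin m × Fin m) ⊕ Fin m

/-- A model of `T⁰` with `m` independent vectors and a base point of `Q` with trivial
Witt defect. -/
structure Frame (w : Bool) (m : ℕ) where
  G : QuadraticGeometry.{u}
  ω : w = true → G.Q → G.K
  isWittDefect : ∀ h, G.IsWittDefect (ω h)
  e : Fin m → G.V
  indep : LinearIndependent G.K e
  q : G.Q
  ω_q : ∀ h, ω h q = 0

namespace Frame

variable {w : Bool} {m : ℕ} (C : Frame.{u} w m)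

/-- The model underlying a frame. -/
noncomputable abbrev str : Str.{u} (lang w) := C.G.toStr w C.ω

/-- The vector with given coordinates. -/
noncomputable def vec (x : Fin m → C.G.K) : C.G.V := ∑ i, x i • C.e i

/-- The element of a given sort with given coordinates; the coordinates of an element of `Q` are
those of its difference with the base point. -/
noncomputable def decode : ∀ s, (Coord m s → C.G.K) → C.G.carrier s
  | .K, x => x ()
  | .V, x => C.vec x
  | .Q, x => C.G.addQ C.q (C.vec x)

/-- The values of the bilinear form and of the base form at the chosen vectors. -/
def gram : GramIndex m → C.G.K
  | .inl p => C.G.betaV (C.e p.1) (C.e p.2)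
  | .inr i => C.G.betaQ C.q (C.e i)

theorem vec_injective : Function.Injective C.vec := by
  intro x y h
  have h1 : ∑ i, (x i - y i) • C.e i = 0 := by
    simp only [sub_smul, Finset.sum_sub_distrib]
    exact sub_eq_zero.2 h
  funext i
  exact sub_eq_zero.1 (Fintype.linearIndependent_iff.1 C.indep _ h1 i)

theorem decode_injective : ∀ s, Function.Injective (C.decode s)
  | .K => fun _ _ h => funext fun _ => h
  | .V => C.vec_injective
  | .Q => (C.G.addQ_injective C.q).comp C.vec_injective

theorem vec_add (x y : Fin m → C.G.K) : C.vec x + C.vec y = C.vec fun i => x i + y i := by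
  simp [vec, add_smul, Finset.sum_add_distrib]

theorem vec_smul (a : C.G.K) (x : Fin m → C.G.K) : a • C.vec x = C.vec fun i => a * x i := by
  simp [vec, Finset.smul_sum, mul_smul]

theorem vec_neg (x : Fin m → C.G.K) : -C.vec x = C.vec fun i => - x i := by
  simp [vec]

theorem vec_sub (x y : Fin m → C.G.K) : C.vec x - C.vec y = C.vec fun i => x i - y i := by
  simp [vec, sub_smul]

theorem sum_smul_vec {n : ℕ} (a : Fin n → C.G.K) (v : Fin n → Fin m → C.G.K) :
    ∑ j, a j • C.vec (v j) = C.vec fun k => ∑ j, a j * v j k := by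
  simp only [vec_smul]
  simp only [vec, Finset.sum_smul]
  exact Finset.sum_comm

theorem betaV_vec (x y : Fin m → C.G.K) :
    C.G.betaV (C.vec x) (C.vec y) = ∑ i, ∑ j, x i * y j * C.gram (.inl (i, j)) := by
  simp only [vec, gram, map_sum, map_smul, LinearMap.sum_apply, LinearMap.smul_apply, smul_eq_mul,
    Finset.mul_sum]
  rw [Finset.sum_comm]
  exact Finset.sum_congr rfl fun i _ => Finset.sum_congr rfl fun j _ => by ring

theorem betaQ_vec (x : Fin m → C.G.K) :
    C.G.betaQ C.q (C.vec x) = ∑ i, x i ^ 2 * C.gram (.inr i) +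
      ∑ i, ∑ j, if i < j then x i * x j * C.gram (.inl (i, j)) else 0 :=
  C.G.betaQ_sum C.q C.e x

end Frame

/-- Linear independence of tuples of coordinate vectors, in coordinates. -/
def IndepCoord (K : Type u) [Field K] {n m : ℕ} (v : Fin n → Fin m → K) : Prop :=
  ∀ a : Fin n → K, (∀ k, ∑ j, a j * v j k = 0) → ∀ j, a j = 0

/-- The coordinate functions on coordinate vectors are defined for independent tuples, on
their span. -/
def CoordDefined (K : Type u) [Field K] {n m : ℕ} (v : Fin n → Fin m → K) (x : Fin m → K) :
    Prop :=
  IndepCoord K v ∧ ∃ a : Fin n → K, ∀ k, x k = ∑ j, a j * v j k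

open Classical in
/-- The coordinates of one coordinate vector with respect to others. -/
noncomputable def coordOf (K : Type u) [Field K] {n m : ℕ} (v : Fin n → Fin m → K)
    (x : Fin m → K) (i : Fin n) : K :=
  if h : CoordDefined K v x then h.2.choose i else 0

theorem IndepCoord.unique {K : Type u} [Field K] {n m : ℕ} {v : Fin n → Fin m → K}
    (hv : IndepCoord K v) {a b : Fin n → K}
    (h : ∀ k, ∑ j, a j * v j k = ∑ j, b j * v j k) : a = b := by
  have h1 := hv (fun j => a j - b j) fun k => by
    simp only [sub_mul, Finset.sum_sub_distrib, h, sub_self]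
  exact funext fun j => sub_eq_zero.1 (h1 j)

theorem eq_coordOf_iff {K : Type u} [Field K] {n m : ℕ} (v : Fin n → Fin m → K)
    (x : Fin m → K) (i : Fin n) (d : K) : d = coordOf K v x i ↔
      (IndepCoord K v ∧ ∃ a : Fin n → K, (∀ k, x k = ∑ j, a j * v j k) ∧ d = a i) ∨
      (¬ CoordDefined K v x ∧ d = 0) := by
  unfold coordOf
  split_ifs with h
  · have h1 := h.2.choose_spec
    constructor
    · exact fun hd => .inl ⟨h.1, _, h1, hd⟩
    · rintro (⟨h2, a, ha, rfl⟩ | h2)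
      · rw [h2.unique fun k => (ha k).symm.trans (h1 k)]
      · exact absurd h h2.1
  · constructor
    · exact fun hd => .inr ⟨h, hd⟩
    · rintro (⟨h2, a, ha, -⟩ | h2)
      · exact absurd ⟨h2, a, ha⟩ h
      · exact h2.2

namespace Frame

variable {w : Bool} {m : ℕ} (C : Frame.{u} w m)

theorem linearIndependent_vec_iff {n : ℕ} (v : Fin n → Fin m → C.G.K) :
    LinearIndependent C.G.K (fun j => C.vec (v j)) ↔ IndepCoord C.G.K v := by
  have h0 : C.vec (fun _ => 0) = 0 := by simp [vec]
  rw [Fintype.linearIndependent_iff]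
  refine forall_congr' fun a => imp_congr_left ?_
  rw [C.sum_smul_vec, ← h0, C.vec_injective.eq_iff, funext_iff]

theorem coordinate_vec {n : ℕ} (v : Fin n → Fin m → C.G.K) (x : Fin m → C.G.K) (i : Fin n) :
    C.G.coordinate (fun j => C.vec (v j)) (C.vec x) i = coordOf C.G.K v x i := by
  have hmem : C.vec x ∈ Submodule.span C.G.K (Set.range fun j => C.vec (v j)) ↔
      ∃ a : Fin n → C.G.K, ∀ k, x k = ∑ j, a j * v j k := by
    rw [Submodule.mem_span_range_iff_exists_fun]
    refine exists_congr fun a => ?_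
    rw [C.sum_smul_vec, C.vec_injective.eq_iff, funext_iff]
    exact forall_congr' fun k => eq_comm
  rw [eq_coordOf_iff]
  unfold QuadraticGeometry.coordinate
  split_ifs with h
  · left
    refine ⟨(C.linearIndependent_vec_iff v).1 h.1, fun j => h.1.repr ⟨_, h.2⟩ j, fun k => ?_, rfl⟩
    have h1 := h.1.linearCombination_repr ⟨_, h.2⟩
    rw [Finsupp.linearCombination_apply, Finsupp.sum_fintype _ _ (by simp),
      C.sum_smul_vec] at h1
    exact (congrFun (C.vec_injective h1) k).symm
  · right
    refine ⟨fun h1 => h ?_, rfl⟩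
    exact ⟨(C.linearIndependent_vec_iff v).2 h1.1, hmem.2 h1.2⟩

/-- The Witt defect is the Artin–Schreier class of the value of the base form. -/
theorem omega_addQ (h : w = true) (v : C.G.V) :
    C.ω h (C.G.addQ C.q v) = artinSchreierClass (C.G.betaQ C.q v) := by
  have h1 := (C.isWittDefect h).eq_iff (C.G.addQ C.q v) C.q
  have h2 : C.G.subQ (C.G.addQ C.q v) C.q = v := (C.G.addQ_eq_iff.1 rfl).symm
  rw [h2, C.G.betaQ_addQ, C.G.betaV_alternating, C.ω_q h] at h1
  simp only [ne_eq, OfNat.ofNat_ne_zero, not_false_eq_true, zero_pow, add_zero] at h1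
  unfold artinSchreierClass
  split_ifs with h3
  · exact h1.2 h3
  · exact ((C.isWittDefect h).zero_or_one _).resolve_left fun h4 => h3 (h1.1 h4)

end Frame

section

variable {α : Type}

theorem definable_indepCoord {n m : ℕ} {v : Fin n → Fin m → FieldFun.{u} α}
    (hv : ∀ j k, (v j k).Definable) :
    FieldPred.Definable.{u} fun K _ (c : α → K) => IndepCoord K fun j k => v j k K c := by
  have hv' : ∀ j k, FieldFun.Definable.{u} (α := α ⊕ Fin n) fun K _ c =>
      v j k K fun a => c (.inl a) := fun j k =>
    FieldPred.Definable.relabel (hv j k) (fun o : Option α => o.map (Sum.inl (β := Fin n)))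
  refine FieldPred.Definable.forall_tuple (ι := Fin n)
    (P := fun K _ c a => (∀ k, ∑ j, a j * v j k K c = 0) → ∀ j, a j = 0) ?_
  refine FieldPred.Definable.imp (.forall_index fun k => .equal (.sum _ fun j => ?_) .zero)
    (.forall_index fun j => .equal (.proj _) .zero)
  exact .mul (.proj _) (hv' j k)

theorem definable_coordOf {n m : ℕ} {v : Fin n → Fin m → FieldFun.{u} α}
    {x : Fin m → FieldFun.{u} α} (hv : ∀ j k, (v j k).Definable) (hx : ∀ k, (x k).Definable)
    (i : Fin n) : FieldFun.Definable.{u} fun K _ (c : α → K) =>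
      coordOf K (fun j k => v j k K c) (fun k => x k K c) i := by
  have hsome : ∀ {F : FieldFun.{u} α}, F.Definable →
      FieldFun.Definable.{u} (α := Option α) fun K _ c => F K fun a => c (some a) :=
    fun hF => FieldPred.Definable.relabel hF (fun o : Option α => o.map some)
  have hinl : ∀ {F : FieldFun.{u} (Option α)}, F.Definable →
      FieldFun.Definable.{u} (α := Option α ⊕ Fin n) fun K _ c => F K fun a => c (.inl a) :=
    fun hF => FieldPred.Definable.relabel hF
      (fun o : Option (Option α) => o.map (Sum.inl (β := Fin n)))
  have h1 : FieldPred.Definable.{u} (α := Option α) fun K _ c =>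
      IndepCoord K fun j k => v j k K fun a => c (some a) :=
    definable_indepCoord (v := fun j k K _ c => v j k K fun a => c (some a))
      fun j k => hsome (hv j k)
  have h2 : FieldPred.Definable.{u} (α := Option α ⊕ Fin n) fun K _ c =>
      ∀ k, x k K (fun a => c (.inl (some a))) =
        ∑ j, c (.inr j) * v j k K fun a => c (.inl (some a)) :=
    .forall_index fun k => .equal (hinl (hsome (hx k)))
      (.sum _ fun j => .mul (.proj _) (hinl (hsome (hv j k))))
  have h3 : FieldPred.Definable.{u} (α := Option α) fun K _ c =>
      ∃ a : Fin n → K, (∀ k, x k K (fun a => c (some a)) =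
        ∑ j, a j * v j k K fun a => c (some a)) ∧ c none = a i :=
    .exists_tuple (P := fun K _ c a => (∀ k, x k K (fun a => c (some a)) =
        ∑ j, a j * v j k K fun a => c (some a)) ∧ c none = a i)
      (h2.and (.equal (.proj _) (.proj _)))
  have h4 : FieldPred.Definable.{u} (α := Option α) fun K _ c =>
      ∃ a : Fin n → K, ∀ k, x k K (fun a => c (some a)) =
        ∑ j, a j * v j k K fun a => c (some a) :=
    .exists_tuple (P := fun K _ c a => ∀ k, x k K (fun a => c (some a)) =
        ∑ j, a j * v j k K fun a => c (some a)) h2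
  exact ((h1.and h3).or ((h1.and h4).not.and (.equal (.proj none) .zero))).congr
    fun K _ c => eq_coordOf_iff _ _ _ _

theorem definable_isArtinSchreier {F : FieldFun.{u} α} (hF : F.Definable) :
    FieldPred.Definable.{u} fun K _ (c : α → K) => IsArtinSchreier (F K c) := by
  have hsome : FieldFun.Definable.{u} (α := Option α) fun K _ c => F K fun a => c (some a) :=
    FieldPred.Definable.relabel hF (fun o : Option α => o.map some)
  exact .exists_elem (P := fun K _ c x => F K c = x ^ 2 - x)
    (.equal hsome (.sub (.sq (.proj _)) (.proj _)))

end

/-- The value of a function symbol has coordinates that are definable functions of the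
coordinates of the arguments and of the Gram data. -/
theorem exists_definable_function (w : Bool) (m : ℕ) {n : ℕ} {a : Fin n → Srt} {s : Srt}
    (f : Func w a s) :
    ∃ F : Coord m s → FieldFun.{u} ((Σ i, Coord m (a i)) ⊕ GramIndex m),
      (∀ j, (F j).Definable) ∧
      ∀ (C : Frame.{u} w m) (y : ∀ i, Coord m (a i) → C.G.K),
        C.G.interpFunc C.ω f (fun i => C.decode (a i) (y i)) =
          C.decode s fun j => F j C.G.K (Sum.elim (fun p => y p.1 p.2) C.gram) := by
  cases f with
  | @ring n f =>
    refine ⟨fun _ K _ c => (FirstOrder.Ring.compatibleRingOfRing K).toStructure.funMap f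
      fun i => c (.inl ⟨i, ()⟩), fun _ => ?_, fun C y => rfl⟩
    exact .of_term (FirstOrder.Language.Term.func f fun i =>
      FirstOrder.Language.Term.var (.inl ⟨i, ()⟩)) _ fun K _ c => rfl
  | vzero =>
    refine ⟨fun _ _ _ _ => 0, fun _ => .zero, fun C y => ?_⟩
    change (0 : C.G.V) = C.vec fun _ => 0
    simp [Frame.vec]
  | vadd =>
    exact ⟨fun j K _ c => c (.inl ⟨0, j⟩) + c (.inl ⟨1, j⟩),
      fun j => .add (.proj _) (.proj _), fun C y => C.vec_add _ _⟩
  | vneg =>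
    exact ⟨fun j K _ c => - c (.inl ⟨0, j⟩), fun j => .neg (.proj _), fun C y => C.vec_neg _⟩
  | smul =>
    exact ⟨fun j K _ c => c (.inl ⟨0, ()⟩) * c (.inl ⟨1, j⟩),
      fun j => .mul (.proj _) (.proj _), fun C y => C.vec_smul _ _⟩
  | coord n i =>
    refine ⟨fun _ K _ c => coordOf K (fun (j : Fin n) (k : Fin m) => c (.inl ⟨j.castSucc, k⟩))
      (fun k : Fin m => c (.inl ⟨Fin.last n, k⟩)) i, fun _ => ?_, fun C y => C.coordinate_vec _ _ _⟩
    exact definable_coordOf (α := (Σ _ : Fin (n + 1), Coord m Srt.V) ⊕ GramIndex m)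
      (v := fun (j : Fin n) (k : Fin m) K _ c => c (Sum.inl ⟨j.castSucc, k⟩))
      (x := fun (k : Fin m) K _ c => c (Sum.inl ⟨Fin.last n, k⟩))
      (fun _ _ => .proj _) (fun _ => .proj _) i
  | betaV =>
    exact ⟨fun _ K _ c => ∑ i : Fin m, ∑ j : Fin m,
      c (.inl ⟨0, i⟩) * c (.inl ⟨1, j⟩) * c (.inr (.inl (i, j))),
      fun _ => .sum _ fun i => .sum _ fun j => .mul (.mul (.proj _) (.proj _)) (.proj _),
      fun C y => C.betaV_vec _ _⟩
  | addQ =>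
    exact ⟨fun j K _ c => c (.inl ⟨0, j⟩) + c (.inl ⟨1, j⟩),
      fun j => .add (.proj _) (.proj _), fun C y =>
        (C.G.addQ_add _ _ _).symm.trans (congrArg (C.G.addQ C.q) (C.vec_add _ _))⟩
  | subQ =>
    exact ⟨fun j K _ c => c (.inl ⟨0, j⟩) - c (.inl ⟨1, j⟩),
      fun j => .sub (.proj _) (.proj _), fun C y =>
        (C.G.subQ_addQ _ _ _).trans (C.vec_sub _ _)⟩
  | betaQ =>
    refine ⟨fun _ K _ c => (∑ i : Fin m, c (.inl ⟨1, i⟩) ^ 2 * c (.inr (.inr i)) +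
      ∑ i : Fin m, ∑ j : Fin m,
        if i < j then c (.inl ⟨1, i⟩) * c (.inl ⟨1, j⟩) * c (.inr (.inl (i, j))) else 0) +
      (∑ i : Fin m, ∑ j : Fin m,
        c (.inl ⟨0, i⟩) * c (.inl ⟨1, j⟩) * c (.inr (.inl (i, j)))) ^ 2, fun _ => ?_,
      fun C y => ?_⟩
    · refine .add (.add (.sum _ fun i => .mul (.sq (.proj _)) (.proj _))
        (.sum _ fun i => .sum _ fun j => ?_))
        (.sq (.sum _ fun i => .sum _ fun j => .mul (.mul (.proj _) (.proj _)) (.proj _)))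
      exact .ite_const _ (.mul (.mul (.proj _) (.proj _)) (.proj _)) .zero
    · exact (C.G.betaQ_addQ _ _ _).trans
        (congrArg₂ (fun a b => a + b ^ 2) (C.betaQ_vec _) (C.betaV_vec _ _))
  | omega h =>
    refine ⟨fun _ K _ c => artinSchreierClass
      (∑ i : Fin m, c (.inl ⟨0, i⟩) ^ 2 * c (.inr (.inr i)) +
      ∑ i : Fin m, ∑ j : Fin m,
        if i < j then c (.inl ⟨0, i⟩) * c (.inl ⟨0, j⟩) * c (.inr (.inl (i, j))) else 0),
      fun _ => ?_, fun C y => ?_⟩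
    · refine .ite (definable_isArtinSchreier ?_) .zero .one
      refine .add (.sum _ fun i => .mul (.sq (.proj _)) (.proj _))
        (.sum _ fun i => .sum _ fun j => ?_)
      exact .ite_const _ (.mul (.mul (.proj _) (.proj _)) (.proj _)) .zero
    · exact (C.omega_addQ h _).trans (congrArg artinSchreierClass (C.betaQ_vec _))

/-- The index type for the coordinates of the variables of a context together with the
Gram data. -/
abbrev DataIndex (Γ : List Srt) (m : ℕ) : Type :=
  (Σ p : (Σ s, Var Γ s), Coord m p.1) ⊕ GramIndex m

instance finite_var : ∀ Γ : List Srt, Finite (Σ s, Var Γ s)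
  | [] => by
    have : IsEmpty (Σ s, Var ([] : List Srt) s) := ⟨fun p => nomatch p.2⟩
    infer_instance
  | t :: Γ => by
    have := finite_var Γ
    let g : Option (Σ s, Var Γ s) → Σ s, Var (t :: Γ) s := fun o =>
      o.elim ⟨t, .zero⟩ fun p => ⟨p.1, .succ p.2⟩
    refine Finite.of_surjective g ?_
    rintro ⟨s, _ | v⟩
    · exact ⟨none, rfl⟩
    · exact ⟨some ⟨s, v⟩, rfl⟩

/-- Coordinates for the variables of a context. -/
abbrev CoordAssignment (K : Type u) (Γ : List Srt) (m : ℕ) : Type u :=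
  ∀ s, Var Γ s → Coord m s → K

/-- Adjoin the coordinates of a new variable. -/
def CoordAssignment.cons {K : Type u} {Γ : List Srt} {m : ℕ} {t : Srt} (y : Coord m t → K)
    (x : CoordAssignment K Γ m) : CoordAssignment K (t :: Γ) m
  | _, .zero => y
  | _, .succ v => x _ v

namespace Frame

variable {w : Bool} {m : ℕ} (C : Frame.{u} w m) {Γ : List Srt}

/-- All field elements on which the truth of a formula depends. -/
def data (x : CoordAssignment C.G.K Γ m) : DataIndex Γ m → C.G.K :=
  Sum.elim (fun p => x p.1.1 p.1.2 p.2) C.gram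

/-- The assignment with given coordinates. -/
noncomputable def assign (x : CoordAssignment C.G.K Γ m) : Assignment C.str Γ :=
  fun s v => C.decode s (x s v)

theorem assign_cons {t : Srt} (y : Coord m t → C.G.K) (x : CoordAssignment C.G.K Γ m) :
    C.assign (x.cons y) = Assignment.cons (M := C.str) (C.decode t y) (C.assign x) := by
  funext s v
  cases v <;> rfl

end Frame

/-- The value of a term has coordinates that are definable functions of the data. -/
theorem exists_definable_term (w : Bool) (m : ℕ) {Γ : List Srt} {s : Srt}
    (t : Term (lang w) Γ s) :
    ∃ F : Coord m s → FieldFun.{u} (DataIndex Γ m), (∀ j, (F j).Definable) ∧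
      ∀ (C : Frame.{u} w m) (x : CoordAssignment C.G.K Γ m),
        t.eval C.str (C.assign x) = C.decode s fun j => F j C.G.K (C.data x) := by
  induction t with
  | @var s v => exact ⟨fun j _ _ c => c (.inl ⟨⟨s, v⟩, j⟩), fun j => .proj _, fun C x => rfl⟩
  | @func n a s f ts ih =>
    choose G hG hG' using ih
    obtain ⟨F, hF, hF'⟩ := exists_definable_function.{u} w m f
    let H : (Σ i, Coord m (a i)) ⊕ GramIndex m → FieldFun.{u} (DataIndex Γ m) :=
      Sum.elim (fun p => G p.1 p.2) fun g _ _ c => c (.inr g)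
    have hH : ∀ i, (H i).Definable := by
      rintro (p | g)
      · exact hG p.1 p.2
      · exact .proj _
    refine ⟨fun j K _ c => F j K fun i => H i K c, fun j => (hF j).comp hH, fun C x => ?_⟩
    have h1 : (fun i => (ts i).eval C.str (C.assign x)) =
        fun i => C.decode (a i) fun j => G i j C.G.K (C.data x) := funext fun i => hG' i C x
    have h2 : (fun i => H i C.G.K (C.data x)) =
        Sum.elim (fun p => G p.1 p.2 C.G.K (C.data x)) C.gram := by
      funext i
      rcases i with p | g <;> rfl
    exact (congrArg (C.G.interpFunc C.ω f) h1).trans ((hF' C _).trans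
      (congrArg (C.decode s) (funext fun j => congrArg (F j C.G.K) h2.symm)))

/-! ### Extension of frames -/

/-- A coordinate in a geometry with `m + 1` chosen vectors is `none` if it belongs to the first
of them. -/
def Coord.drop {m : ℕ} : ∀ {s : Srt}, Coord (m + 1) s → Option (Coord m s)
  | .K, j => some j
  | .V, j => Fin.cases none some (j : Fin (m + 1))
  | .Q, j => Fin.cases none some (j : Fin (m + 1))

/-- Coordinates with respect to `m` vectors, read with respect to `m + 1` vectors. -/
def Coord.extend {K : Type u} [Zero K] {m : ℕ} {s : Srt} (y : Coord m s → K)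
    (j : Coord (m + 1) s) : K :=
  (Coord.drop j).elim 0 y

/-- The index of a coordinate of the first vector: `true` where the coordinate is `1`. -/
def Coord.unit {m : ℕ} : ∀ {s : Srt}, Coord (m + 1) s → Bool
  | .K, _ => false
  | .V, j => Fin.cases true (fun _ => false) (j : Fin (m + 1))
  | .Q, j => Fin.cases true (fun _ => false) (j : Fin (m + 1))

namespace Frame

variable {w : Bool} {m : ℕ} (C : Frame.{u} w m) {Γ : List Srt}

/-- A frame with one more vector. -/
def extend (v : C.G.V) (hv : v ∉ Submodule.span C.G.K (Set.range C.e)) : Frame.{u} w (m + 1) where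
  G := C.G
  ω := C.ω
  isWittDefect := C.isWittDefect
  e := Fin.cons v C.e
  indep := C.indep.finCons hv
  q := C.q
  ω_q := C.ω_q

/-- The element of the sort `V` or `Q` given by a vector. -/
def place : ∀ s, C.G.V → C.G.carrier s
  | .K, _ => (0 : C.G.K)
  | .V, v => v
  | .Q, v => C.G.addQ C.q v

theorem decode_eq_place : ∀ {s : Srt}, s ≠ .K → ∀ x : Fin m → C.G.K, ∃ y,
    C.decode s y = C.place s (C.vec x)
  | .K, h, _ => absurd rfl h
  | .V, _, x => ⟨x, rfl⟩
  | .Q, _, x => ⟨x, rfl⟩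

theorem place_surjective : ∀ {s : Srt}, s ≠ .K → Function.Surjective (C.place s)
  | .K, h => absurd rfl h
  | .V, _ => fun v => ⟨v, rfl⟩
  | .Q, _ => C.G.addQ_surjective C.q

theorem exists_vec_eq {v : C.G.V} (hv : v ∈ Submodule.span C.G.K (Set.range C.e)) :
    ∃ x, C.vec x = v :=
  (Submodule.mem_span_range_iff_exists_fun C.G.K).1 hv

theorem decode_surjective (hs : Submodule.span C.G.K (Set.range C.e) = ⊤) (s : Srt) :
    Function.Surjective (C.decode s) := by
  intro z
  by_cases h : s = .K
  · subst h
    exact ⟨fun _ => z, rfl⟩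
  · obtain ⟨v, rfl⟩ := C.place_surjective h z
    obtain ⟨x, rfl⟩ := C.exists_vec_eq (hs ▸ Submodule.mem_top : v ∈ _)
    exact C.decode_eq_place h x

variable (v : C.G.V) (hv : v ∉ Submodule.span C.G.K (Set.range C.e))

theorem vec_extend (x : Fin (m + 1) → C.G.K) :
    (C.extend v hv).vec x = x 0 • v + C.vec fun i => x i.succ := by
  refine (Fin.sum_univ_succ _).trans ?_
  rfl

theorem decode_extend : ∀ {s : Srt} (y : Coord m s → C.G.K),
    (C.extend v hv).decode s (Coord.extend y) = C.decode s y
  | .K, y => rfl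
  | .V, y => by
    refine (C.vec_extend v hv _).trans ?_
    change (0 : C.G.K) • v + C.vec y = _
    rw [zero_smul, zero_add]
    rfl
  | .Q, y => by
    refine congrArg (C.G.addQ C.q) ((C.vec_extend v hv _).trans ?_)
    change (0 : C.G.K) • v + C.vec y = _
    rw [zero_smul, zero_add]

/-- The elements `0` and `1` of a field. -/
def bit (K : Type u) [Field K] (b : Bool) : K := if b then 1 else 0

theorem decode_unit : ∀ {s : Srt}, s ≠ .K →
    (C.extend v hv).decode s (fun j => bit C.G.K (Coord.unit j)) = C.place s v
  | .K, h => absurd rfl h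
  | .V, _ => by
    refine (C.vec_extend v hv _).trans ?_
    change (1 : C.G.K) • v + C.vec (fun _ => (0 : C.G.K)) = _
    simp [vec, place]
  | .Q, _ => by
    refine congrArg (C.G.addQ C.q) ((C.vec_extend v hv _).trans ?_)
    change (1 : C.G.K) • v + C.vec (fun _ => (0 : C.G.K)) = _
    simp [vec]

theorem assign_extend (x : CoordAssignment C.G.K Γ m) :
    (C.extend v hv).assign (fun s a => Coord.extend (x s a)) = C.assign x :=
  funext fun _ => funext fun a => C.decode_extend v hv (x _ a)

end Frame

/-- The source of each of the data for a context with one more variable, whose coordinates are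
new. -/
def consIndex {Γ : List Srt} {m : ℕ} {t : Srt} :
    DataIndex (t :: Γ) m → DataIndex Γ m ⊕ Coord m t
  | .inl ⟨⟨_, .zero⟩, j⟩ => .inr j
  | .inl ⟨⟨s, .succ v⟩, j⟩ => .inl (.inl ⟨⟨s, v⟩, j⟩)
  | .inr g => .inl (.inr g)

theorem Frame.data_cons {w : Bool} {m : ℕ} (C : Frame.{u} w m) {Γ : List Srt} {t : Srt}
    (y : Coord m t → C.G.K) (x : CoordAssignment C.G.K Γ m) :
    C.data (x.cons y) = fun i => Sum.elim (C.data x) y (consIndex i) := by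
  funext i
  rcases i with ⟨⟨s, _ | v⟩, j⟩ | g <;> rfl

/-- The source of each of the data for a context with one more variable, which stands for a new
vector `v` (or the corresponding element of `Q`): the old data, the values
`β(e_i, v)` (the index `some i`) and `q(v)` (the index `none`), and the constants `0` and `1`. -/
def extendIndex {Γ : List Srt} {m : ℕ} {t : Srt} :
    DataIndex (t :: Γ) (m + 1) → (DataIndex Γ m ⊕ Option (Fin m)) ⊕ Bool
  | .inl ⟨⟨_, .zero⟩, j⟩ => .inr (Coord.unit j)
  | .inl ⟨⟨s, .succ v⟩, j⟩ =>
    (Coord.drop j).elim (.inr false) fun j' => .inl (.inl (.inl ⟨⟨s, v⟩, j'⟩))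
  | .inr (.inl (i, j)) =>
    Fin.cases (Fin.cases (.inr false) (fun j' => .inl (.inr (some j'))) j)
      (fun i' => Fin.cases (.inl (.inr (some i')))
        (fun j' => .inl (.inl (.inr (.inl (i', j'))))) j) i
  | .inr (.inr i) =>
    Fin.cases (.inl (.inr none)) (fun i' => .inl (.inl (.inr (.inr i')))) i

theorem Frame.data_extend {w : Bool} {m : ℕ} (C : Frame.{u} w m) {Γ : List Srt} {t : Srt}
    (v : C.G.V) (hv : v ∉ Submodule.span C.G.K (Set.range C.e))
    (x : CoordAssignment C.G.K Γ m) (b : Option (Fin m) → C.G.K)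
    (hb : ∀ i, C.G.betaV (C.e i) v = b (some i)) (hq : C.G.betaQ C.q v = b none) :
    (C.extend v hv).data (CoordAssignment.cons (t := t)
      (fun j => Frame.bit C.G.K (Coord.unit j)) fun s a => Coord.extend (x s a)) =
    fun i => Sum.elim (Sum.elim (C.data x) b) (Frame.bit C.G.K) (extendIndex i) := by
  funext i
  rcases i with ⟨⟨s, _ | a⟩, j⟩ | ⟨i, j⟩ | i
  · rfl
  · change (Coord.drop j).elim 0 (x s a) = Sum.elim _ _ ((Coord.drop j).elim _ _)
    cases Coord.drop j <;> rfl
  · cases i using Fin.cases <;> cases j using Fin.cases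
    · exact C.G.betaV_alternating v
    · exact (C.G.betaV_comm _ _).trans (hb _)
    · exact hb _
    · rfl
  · cases i using Fin.cases
    · exact hq
    · rfl

/-! ### Definability of formulas -/

namespace Frame

/-- The hypotheses under which truth of a formula is governed by a formula about the field: the
field is perfect, and the chosen vectors span `V` (if `full` is true) or the dimension is at
least `N` (otherwise). -/
structure IsGood {w : Bool} {m : ℕ} (C : Frame.{u} w m) (full : Bool) (N : ℕ) : Prop where
  exists_sq : ∀ a : C.G.K, ∃ b, b ^ 2 = a
  span_eq : full = true → Submodule.span C.G.K (Set.range C.e) = ⊤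
  dim_ge : full = false → ∃ f : Fin N → C.G.V, LinearIndependent C.G.K f

variable {w : Bool} {m : ℕ} {C : Frame.{u} w m} {full : Bool}

theorem IsGood.mono {N N' : ℕ} (h : C.IsGood full N) (hN : N' ≤ N) : C.IsGood full N' where
  exists_sq := h.exists_sq
  span_eq := h.span_eq
  dim_ge hf := by
    obtain ⟨f, hf⟩ := h.dim_ge hf
    exact ⟨fun i => f (Fin.castLE hN i), hf.comp _ (Fin.castLE_injective hN)⟩

end Frame

theorem definable_bit {α : Type} (b : Bool) :
    FieldFun.Definable.{u} (α := α) fun K _ _ => Frame.bit K b := by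
  cases b
  · exact .zero
  · exact .one

/-- In the case of large dimension, quantification over a sort amounts to quantification over the
elements with coordinates and over the possible data of a new vector. -/
theorem Frame.forall_iff {w : Bool} {m N : ℕ} (C : Frame.{u} w m) (hC : C.IsGood false N)
    (hN : 2 * m + 3 ≤ N) {Γ : List Srt} {t : Srt} (ht : t ≠ .K) (x : CoordAssignment C.G.K Γ m)
    (R : C.G.carrier t → Prop) (P : FieldPred.{u} (DataIndex (t :: Γ) (m + 1)))
    (hP : ∀ v hv, R (C.place t v) ↔ P C.G.K ((C.extend v hv).data (CoordAssignment.cons (t := t)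
      (fun j => Frame.bit C.G.K (Coord.unit j)) fun s a => Coord.extend (x s a)))) :
    (∀ z, R z) ↔ (∀ y, R (C.decode t y)) ∧ ∀ b : Option (Fin m) → C.G.K, P C.G.K
      fun i => Sum.elim (Sum.elim (C.data x) b) (Frame.bit C.G.K) (extendIndex i) := by
  constructor
  · refine fun h => ⟨fun y => h _, fun b => ?_⟩
    obtain ⟨f, hf⟩ := hC.dim_ge rfl
    obtain ⟨v, hv, hvb, hvq⟩ := C.G.exists_extension hC.exists_sq C.q C.indep hN hf
      (fun i => b (some i)) (b none)
    rw [← C.data_extend v hv x b hvb hvq]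
    exact (hP v hv).1 (h _)
  · rintro ⟨h1, h2⟩ z
    obtain ⟨v, rfl⟩ := C.place_surjective ht z
    by_cases hv : v ∈ Submodule.span C.G.K (Set.range C.e)
    · obtain ⟨y, rfl⟩ := C.exists_vec_eq hv
      obtain ⟨y', hy'⟩ := C.decode_eq_place ht y
      rw [← hy']
      exact h1 y'
    · rw [hP v hv, C.data_extend v hv x (fun o => o.elim (C.G.betaQ C.q v)
        fun i => C.G.betaV (C.e i) v) (fun _ => rfl) rfl]
      exact h2 _

/-- Relative quantifier elimination: the truth of a formula under an assignment is a definable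
property of the data, provided that the dimension is large or the chosen vectors
span `V`. -/
theorem exists_definable_formula (w full : Bool) {Γ : List Srt} (φ : Formula (lang w) Γ) :
    ∀ m : ℕ, ∃ (N : ℕ) (P : FieldPred.{u} (DataIndex Γ m)), P.Definable ∧
      ∀ C : Frame.{u} w m, C.IsGood full N → ∀ x : CoordAssignment C.G.K Γ m,
        (φ.Realize C.str (C.assign x) ↔ P C.G.K (C.data x)) := by
  induction φ with
  | falsum => exact fun m => ⟨0, _, .falsum, fun C _ x => Iff.rfl⟩
  | @equal Γ s t₁ t₂ =>
    intro m
    obtain ⟨F₁, hF₁, h₁⟩ := exists_definable_term.{u} w m t₁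
    obtain ⟨F₂, hF₂, h₂⟩ := exists_definable_term.{u} w m t₂
    refine ⟨0, _, .forall_index fun j => .equal (hF₁ j) (hF₂ j), fun C _ x => ?_⟩
    change Term.eval _ _ _ = Term.eval _ _ _ ↔ _
    rw [h₁, h₂, ← funext_iff]
    exact (C.decode_injective s).eq_iff
  | @rel Γ n a R ts =>
    intro m
    choose F hF h using fun i => exists_definable_term.{u} w m (ts i)
    cases R with
    | theta hn =>
      refine ⟨0, _, definable_indepCoord (v := fun (i : Fin n) (k : Fin m) => F i k)
        fun i k => hF i k, fun C _ x => ?_⟩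
      have h1 : (fun i => (ts i).eval C.str (C.assign x)) = _ := funext fun i => h i C x
      refine (iff_of_eq (congrArg (C.G.interpRel (Rel.theta n hn)) h1)).trans ?_
      exact C.linearIndependent_vec_iff _
  | imp φ ψ hφ hψ =>
    intro m
    obtain ⟨N₁, P₁, hP₁, h₁⟩ := hφ m
    obtain ⟨N₂, P₂, hP₂, h₂⟩ := hψ m
    exact ⟨max N₁ N₂, _, hP₁.imp hP₂, fun C hC x =>
      imp_congr (h₁ C (hC.mono (le_max_left _ _)) x) (h₂ C (hC.mono (le_max_right _ _)) x)⟩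
  | @all Γ t φ ih =>
    intro m
    obtain ⟨N₁, P₁, hP₁, h₁⟩ := ih m
    obtain ⟨N₂, P₂, hP₂, h₂⟩ := ih (m + 1)
    -- elements with coordinates
    have hQ₁ : FieldPred.Definable.{u} (α := DataIndex Γ m) fun K _ c =>
        ∀ y : Coord m t → K, P₁ K fun i => Sum.elim c y (consIndex i) := by
      refine .forall_tuple (P := fun K _ c y => P₁ K fun i => Sum.elim c y (consIndex i)) ?_
      refine (hP₁.relabel consIndex).congr fun K _ c => iff_of_eq (congrArg (P₁ K) ?_)
      funext i
      cases consIndex i <;> rfl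
    -- elements given by a vector outside the span of the chosen ones
    have hQ₂ : FieldPred.Definable.{u} (α := DataIndex Γ m) fun K _ c =>
        ∀ b : Option (Fin m) → K, P₂ K fun i =>
          Sum.elim (Sum.elim c b) (Frame.bit K) (extendIndex i) := by
      refine .forall_tuple (P := fun K _ c b => P₂ K fun i =>
        Sum.elim (Sum.elim c b) (Frame.bit K) (extendIndex i)) ?_
      refine (hP₂.comp (F := fun i K _ c => Sum.elim c (Frame.bit K) (extendIndex i))
        fun i => ?_).congr fun K _ c => iff_of_eq (congrArg (P₂ K) ?_)
      · cases extendIndex i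
        · exact .proj _
        · exact definable_bit _
      · funext i
        rcases extendIndex i with (z | z) | z <;> rfl
    refine ⟨max N₁ (max N₂ (2 * m + 3)), _,
      hQ₁.and ((FieldPred.Definable.const (t ≠ .K ∧ full = false)).imp hQ₂), fun C hC x => ?_⟩
    have hdec : (∀ y, φ.Realize C.str
        (Assignment.cons (M := C.str) (C.decode t y) (C.assign x))) ↔
        ∀ y : Coord m t → C.G.K, P₁ C.G.K fun i => Sum.elim (C.data x) y (consIndex i) := by
      refine forall_congr' fun y => ?_
      rw [← C.assign_cons, ← C.data_cons]
      exact h₁ C (hC.mono (le_max_left _ _)) _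
    change (∀ z : C.G.carrier t, φ.Realize C.str
      (Assignment.cons (M := C.str) (z : C.G.carrier t) (C.assign x))) ↔ _
    by_cases hc : t ≠ .K ∧ full = false
    · simp only [hc, ne_eq, not_false_eq_true, and_self, forall_const]
      obtain ⟨ht, rfl⟩ := hc
      rw [← hdec]
      refine C.forall_iff hC (le_trans (le_max_right _ _) (le_max_right _ _)) ht x _ P₂
        fun v hv => ?_
      have hgood : (C.extend v hv).IsGood false N₂ :=
        ⟨hC.exists_sq, nofun,
          (hC.mono (le_trans (le_max_left _ _) (le_max_right _ _))).dim_ge⟩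
      refine Iff.trans (iff_of_eq (congrArg (φ.Realize C.str) ?_)) (h₂ _ hgood _)
      exact (((C.extend v hv).assign_cons _ _).trans (congrArg₂
        (fun z a => Assignment.cons (M := C.str) z a) (C.decode_unit v hv ht)
        (C.assign_extend v hv x))).symm
    · simp only [hc, false_imp_iff, and_true]
      rw [← hdec]
      refine ⟨fun h y => h _, fun h z => ?_⟩
      have hsurj : Function.Surjective (C.decode t) := by
        by_cases ht : t = .K
        · subst ht
          exact fun z => ⟨fun _ => z, rfl⟩
        · cases full
          · exact absurd ⟨ht, rfl⟩ hc
          · exact C.decode_surjective (hC.span_eq rfl) t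
      obtain ⟨y, rfl⟩ := hsurj z
      exact h y

/-! ### Semantics of the axioms -/

section Sat

open FirstOrder FirstOrder.Language FirstOrder.Ring

/-- Truth of a sentence in the language of rings in a field. -/
def FieldSat (K : Type*) [Field K] (σ : Language.ring.Sentence) : Prop :=
  letI := compatibleRingOfRing K
  K ⊨ σ

theorem realize_iff_of_ringEquiv {K L : Type*} [Field K] [Field L] [CompatibleRing K]
    [CompatibleRing L] (e : K ≃+* L) (σ : Language.ring.Sentence) : K ⊨ σ ↔ L ⊨ σ :=
  StrongHomClass.realize_sentence (languageEquivEquivRingEquiv.symm e) σ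

theorem FieldSat.congr {K L : Type*} [Field K] [Field L] (e : K ≃+* L)
    (σ : Language.ring.Sentence) : FieldSat K σ ↔ FieldSat L σ := by
  let _ := compatibleRingOfRing K
  let _ := compatibleRingOfRing L
  exact realize_iff_of_ringEquiv e σ

theorem realize_iff_fieldSat {K : Type*} [Field K] [i : CompatibleRing K]
    (σ : Language.ring.Sentence) : K ⊨ σ ↔ FieldSat K σ :=
  @realize_iff_of_ringEquiv K K _ _ i (compatibleRingOfRing K) (RingEquiv.refl K) σ

theorem fieldSat_not {K : Type*} [Field K] (σ : Language.ring.Sentence) :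
    FieldSat K σ.not ↔ ¬ FieldSat K σ := Iff.rfl

theorem FieldPred.Definable.exists_sentence {P : FieldPred.{u} Empty} (h : P.Definable) :
    ∃ σ : Language.ring.Sentence, ∀ (K : Type u) [Field K], P K Empty.elim ↔ FieldSat K σ := by
  obtain ⟨ψ, hψ⟩ := h
  refine ⟨ψ, fun K _ => (hψ K _).trans (iff_of_eq ?_)⟩
  unfold FieldSat Sentence.Realize
  congr 1
  exact Subsingleton.elim _ _

variable {w : Bool} (G : QuadraticGeometry.{u}) (ω : w = true → G.Q → G.K)

theorem eval_ringTerm {Γ : List Srt} {n : ℕ} (ρ : Fin n → Var Γ Srt.K)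
    (v : Assignment (G.toStr w ω) Γ) (t : Language.ring.Term (Empty ⊕ Fin n)) :
    (ringTerm w ρ t).eval (G.toStr w ω) v =
      (letI := compatibleRingOfRing G.K
       t.realize (Sum.elim (default : Empty → G.K) fun i => (v Srt.K (ρ i) : G.K))) := by
  induction t with
  | var i =>
    rcases i with e | i
    · exact e.elim
    · rfl
  | func f ts ih =>
    exact congrArg ((compatibleRingOfRing G.K).toStructure.funMap f) (funext ih)

theorem realize_ringFormula {n : ℕ} (φ : Language.ring.BoundedFormula Empty n) :
    ∀ {Γ : List Srt} (ρ : Fin n → Var Γ Srt.K) (v : Assignment (G.toStr w ω) Γ),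
    (ringFormula w φ ρ).Realize (G.toStr w ω) v ↔
      (letI := compatibleRingOfRing G.K
       φ.Realize (default : Empty → G.K) fun i => (v Srt.K (ρ i) : G.K)) := by
  induction φ with
  | falsum => exact fun ρ v => Iff.rfl
  | equal t₁ t₂ =>
    intro Γ ρ v
    change (ringTerm w ρ t₁).eval _ v = (ringTerm w ρ t₂).eval _ v ↔ _
    rw [eval_ringTerm, eval_ringTerm]
    rfl
  | rel R => exact isEmptyElim R
  | imp φ ψ hφ hψ => exact fun ρ v => imp_congr (hφ ρ v) (hψ ρ v)
  | all φ ih =>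
    intro Γ ρ v
    refine forall_congr' fun x => (ih _ _).trans (iff_of_eq ?_)
    congr 1
    funext i
    cases i using Fin.lastCases
    · rw [Fin.snoc_last]
      exact (Fin.snoc_last (α := fun _ => G.K) _ _).symm
    · rw [Fin.snoc_castSucc]
      exact (Fin.snoc_castSucc (α := fun _ => G.K) x (fun i => v Srt.K (ρ i)) _).symm

theorem satisfies_aboutK (σ : Language.ring.Sentence) :
    (G.toStr w ω).Satisfies (aboutK w σ) ↔ FieldSat G.K σ := by
  refine (realize_ringFormula G ω σ _ _).trans (iff_of_eq ?_)
  unfold FieldSat Sentence.Realize Language.Formula.Realize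
  congr 1
  exact Subsingleton.elim _ _

end Sat

section Realize

variable {S : Type} {L : ManySorted.Language S} {M : Str.{u} L} {Γ : List S}

theorem satisfies_not {φ : Sentence L} : M.Satisfies φ.not ↔ ¬ M.Satisfies φ := Iff.rfl

theorem satisfies_and {φ ψ : Sentence L} :
    M.Satisfies (φ.and ψ) ↔ M.Satisfies φ ∧ M.Satisfies ψ :=
  Classical.not_imp.trans (and_congr_right fun _ => not_not)

theorem realize_ex {s : S} {φ : Formula L (s :: Γ)} {v : Assignment M Γ} :
    (Formula.ex s φ).Realize M v ↔ ∃ x, φ.Realize M (Assignment.cons x v) :=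
  Classical.not_forall.trans (exists_congr fun _ => not_not)

/-- The assignment given by a tuple of elements of one sort. -/
def tupleAssignment (M : Str.{u} L) (s : S) :
    (m : ℕ) → (Fin m → M.Carrier s) → Assignment M (List.replicate m s)
  | 0, _ => Assignment.nil M
  | m + 1, x => Assignment.cons (x 0) (tupleAssignment M s m fun i => x i.succ)

theorem tupleAssignment_replicate (s : S) : ∀ (m : ℕ) (x : Fin m → M.Carrier s) (i : Fin m),
    tupleAssignment M s m x s (Var.replicate s m i) = x i
  | _ + 1, _, ⟨0, _⟩ => rfl
  | m + 1, _, ⟨i + 1, h⟩ => tupleAssignment_replicate s m _ ⟨i, Nat.lt_of_succ_lt_succ h⟩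

theorem satisfies_exs (s : S) : ∀ (m : ℕ) (φ : Formula L (List.replicate m s)),
    M.Satisfies (Formula.exs s m φ) ↔ ∃ x, φ.Realize M (tupleAssignment M s m x)
  | 0, φ => ⟨fun h => ⟨Fin.elim0, h⟩, fun ⟨_, h⟩ => h⟩
  | m + 1, φ => by
    refine (satisfies_exs s m _).trans ⟨?_, ?_⟩
    · rintro ⟨x, hx⟩
      obtain ⟨y, hy⟩ := realize_ex.1 hx
      exact ⟨Fin.cons y x, hy⟩
    · rintro ⟨x, hx⟩
      exact ⟨fun i => x i.succ, realize_ex.2 ⟨x 0, hx⟩⟩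

end Realize

section Axioms

variable {w : Bool} (G : QuadraticGeometry.{u}) (ω : w = true → G.Q → G.K)

theorem satisfies_nonemptyQ : (G.toStr w ω).Satisfies (nonemptyQ w) ↔ Nonempty G.Q :=
  realize_ex.trans ⟨fun ⟨x, _⟩ => ⟨x⟩, fun ⟨x⟩ => ⟨x, rfl⟩⟩

theorem satisfies_dimGe : ∀ m : ℕ, (G.toStr w ω).Satisfies (dimGe w m) ↔
    ∃ f : Fin m → G.V, LinearIndependent G.K f
  | 0 => ⟨fun _ => ⟨Fin.elim0, linearIndependent_empty_type⟩, fun _ h => h⟩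
  | m + 1 => by
    refine (satisfies_exs _ _ _).trans (exists_congr fun x => ?_)
    have h : (fun i => tupleAssignment (G.toStr w ω) Srt.V (m + 1) x Srt.V
        (Var.replicate Srt.V (m + 1) i)) = x := funext (tupleAssignment_replicate _ _ x)
    exact iff_of_eq (congrArg (fun f : Fin (m + 1) → G.V => LinearIndependent G.K f) h)

theorem finrank_eq_of_dimEq {m : ℕ} (h : (G.toStr w ω).Satisfies (dimEq w m)) :
    Module.Finite G.K G.V ∧ Module.finrank G.K G.V = m := by
  obtain ⟨h1, h2⟩ := satisfies_and.1 h
  rw [satisfies_not, satisfies_dimGe] at h2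
  obtain ⟨f, hf⟩ := (satisfies_dimGe G ω m).1 h1
  have hlt : Module.rank G.K G.V < (m + 1 : ℕ) := not_le.1 fun h => h2 (by
    obtain ⟨f, hf⟩ := exists_linearIndependent_of_le_rank h
    exact ⟨f, hf⟩)
  have hfin : Module.Finite G.K G.V :=
    Module.rank_lt_aleph0_iff.1 (hlt.trans (Cardinal.natCast_lt_aleph0))
  refine ⟨hfin, ?_⟩
  rw [← Module.finrank_eq_rank, Nat.cast_lt] at hlt
  have := hf.fintype_card_le_finrank
  simp only [Fintype.card_fin] at this
  omega

theorem satisfies_dimEq [Module.Finite G.K G.V] {m : ℕ} (h : Module.finrank G.K G.V = m) :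
    (G.toStr w ω).Satisfies (dimEq w m) := by
  refine satisfies_and.2 ⟨(satisfies_dimGe G ω m).2
    (exists_linearIndependent_of_le_finrank h.ge), ?_⟩
  rw [satisfies_not, satisfies_dimGe]
  rintro ⟨f, hf⟩
  have := hf.fintype_card_le_finrank
  simp only [Fintype.card_fin] at this
  omega

theorem exists_linearIndependent_of_not_finite (h : ¬ Module.Finite G.K G.V) (m : ℕ) :
    ∃ f : Fin m → G.V, LinearIndependent G.K f :=
  exists_linearIndependent_of_le_rank (Cardinal.natCast_le_aleph0.trans
    (not_lt.1 fun h' => h (Module.rank_lt_aleph0_iff.1 h')))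

theorem satisfies_cardKEq (m : ℕ) :
    (G.toStr w ω).Satisfies (cardKEq w m) ↔ Cardinal.mk G.K = m := by
  refine satisfies_and.trans ?_
  rw [satisfies_not, satisfies_aboutK, satisfies_aboutK]
  unfold FieldSat
  simp only [FirstOrder.Language.Sentence.realize_cardGe, not_le]
  constructor
  · rintro ⟨h1, h2⟩
    obtain ⟨k, hk⟩ := Cardinal.lt_aleph0.1 (h2.trans Cardinal.natCast_lt_aleph0)
    rw [hk, Nat.cast_le] at h1
    rw [hk, Nat.cast_lt] at h2
    rw [hk]
    exact congrArg _ (by omega)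
  · intro h
    rw [h]
    exact ⟨le_rfl, Nat.cast_lt.2 (Nat.lt_succ_self m)⟩

end Axioms

/-! ### Reduction of sentences to the field -/

instance (m : ℕ) : IsEmpty (Σ p : (Σ s, Var ([] : List Srt) s), Coord m p.1) :=
  ⟨fun p => nomatch p.1.2⟩

theorem Frame.satisfies_iff {w : Bool} {m : ℕ} (C : Frame.{u} w m) (φ : Sentence (lang w))
    (x : CoordAssignment C.G.K [] m) :
    C.str.Satisfies φ ↔ φ.Realize C.str (C.assign x) :=
  iff_of_eq (congrArg (φ.Realize C.str) (funext fun _ => funext fun v => nomatch v))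

/-- In large dimension there is an element of `Q` with trivial Witt defect. -/
theorem exists_omega_eq_zero {w : Bool} {G : QuadraticGeometry.{u}} {ω : w = true → G.Q → G.K}
    (hω : ∀ h, G.IsWittDefect (ω h)) (hK : IsArtinSchreierField G.K) (q : G.Q)
    {f : Fin 3 → G.V} (hf : LinearIndependent G.K f) : ∃ q : G.Q, ∀ h, ω h q = 0 := by
  cases w with
  | false => exact ⟨q, nofun⟩
  | true =>
    rcases (hω rfl).zero_or_one q with h0 | h1
    · exact ⟨q, fun _ => h0⟩
    · -- translation by a vector at which `q` has the nontrivial class changes the defect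
      obtain ⟨c, hc⟩ := hK.exists_not
      obtain ⟨v, -, -, hv⟩ := G.exists_extension hK.exists_sq q
        (linearIndependent_empty_type : LinearIndependent G.K (Fin.elim0 : Fin 0 → G.V))
        le_rfl hf Fin.elim0 c
      refine ⟨G.addQ q v, fun h => ((hω rfl).zero_or_one _).resolve_right fun h2 => hc ?_⟩
      have h3 := ((hω rfl).eq_iff (G.addQ q v) q).1 (h2.trans h1.symm)
      rwa [← G.addQ_eq_iff.1 rfl, G.betaQ_addQ, G.betaV_alternating, hv, zero_pow two_ne_zero,
        add_zero] at h3

/-- In sufficiently large dimension, the truth of a sentence is governed by a sentence about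
the field. -/
theorem exists_sentence_of_large_dim (w : Bool) (φ : Sentence (lang w)) :
    ∃ (N : ℕ) (σ : FirstOrder.Language.ring.Sentence),
      ∀ (G : QuadraticGeometry.{u}) (ω : w = true → G.Q → G.K), (∀ h, G.IsWittDefect (ω h)) →
        IsArtinSchreierField G.K → Nonempty G.Q →
        (∃ f : Fin N → G.V, LinearIndependent G.K f) →
        ((G.toStr w ω).Satisfies φ ↔ FieldSat G.K σ) := by
  obtain ⟨N, P, hP, h⟩ := exists_definable_formula.{u} w false φ 0
  obtain ⟨σ, hσ⟩ := (hP.relabel (β := Empty) isEmptyElim).exists_sentence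
  -- dimension `3` is enough for a base point with trivial Witt defect
  refine ⟨max N 3, σ, fun G ω hω hK ⟨q⟩ ⟨f, hf⟩ => ?_⟩
  have hf' : ∀ k ≤ max N 3, ∃ f : Fin k → G.V, LinearIndependent G.K f := fun k hk =>
    ⟨fun i => f (Fin.castLE hk i), hf.comp _ (Fin.castLE_injective hk)⟩
  obtain ⟨f₃, hf₃⟩ := hf' 3 (le_max_right _ _)
  obtain ⟨q, hq⟩ := exists_omega_eq_zero hω hK q hf₃
  let C : Frame.{u} w 0 := ⟨G, ω, hω, Fin.elim0, linearIndependent_empty_type, q, hq⟩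
  have hC : C.IsGood false N := ⟨hK.exists_sq, nofun, fun _ => hf' N (le_max_left _ _)⟩
  refine (C.satisfies_iff φ fun _ v => nomatch v).trans ((h C hC _).trans ?_)
  refine (iff_of_eq (congrArg (P G.K) ?_)).trans (hσ G.K)
  exact Subsingleton.elim _ _

/-- The data of a frame given by a hyperbolic basis: `true` stands for `1`. -/
def hyperbolicData (n : ℕ) : DataIndex [] (n + n) → Bool
  | .inl p => isEmptyElim p
  | .inr (.inl (i, j)) => decide (finSumFinEquiv.symm j = (finSumFinEquiv.symm i).swap)
  | .inr (.inr _) => false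

/-- In a given finite dimension, the truth of a sentence is governed by a sentence about
the field. -/
theorem exists_sentence_of_finrank_eq (w : Bool) (n : ℕ) (φ : Sentence (lang w)) :
    ∃ σ : FirstOrder.Language.ring.Sentence,
      ∀ (G : QuadraticGeometry.{u}) (ω : w = true → G.Q → G.K), (∀ h, G.IsWittDefect (ω h)) →
        IsArtinSchreierField G.K → Nonempty G.Q → Module.Finite G.K G.V →
        Module.finrank G.K G.V = 2 * n →
        ((G.toStr w ω).Satisfies φ ↔ FieldSat G.K σ) := by
  obtain ⟨N, P, hP, h⟩ := exists_definable_formula.{u} w true φ (n + n)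
  obtain ⟨σ, hσ⟩ := (hP.comp (β := Empty)
    fun i => definable_bit (hyperbolicData n i)).exists_sentence
  refine ⟨σ, fun G ω hω hK ⟨q⟩ hfin hdim => ?_⟩
  obtain ⟨n', b, hb, hs⟩ := G.exists_symplectic_basis
  obtain rfl : n' = n := by
    have := hb.finrank_eq hs
    omega
  obtain ⟨q, hq⟩ := G.exists_betaQ_eq_zero hK.exists_sq q hb.linearIndependent
  have hhyp : G.IsHyperbolic q := QuadraticGeometry.isHyperbolic_iff.2 ⟨n', b, hb, hs, hq⟩
  let C : Frame.{u} w (n' + n') :=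
    { G := G
      ω := ω
      isWittDefect := hω
      e := fun i => b (finSumFinEquiv.symm i)
      indep := hb.linearIndependent.comp _ finSumFinEquiv.symm.injective
      q := q
      ω_q := fun h => ((hω h).eq_zero_iff n' hfin hdim q).2 hhyp }
  have hspan : Submodule.span G.K (Set.range C.e) = ⊤ := by
    rw [← hs]
    exact congrArg _ (finSumFinEquiv.symm.surjective.range_comp b)
  have hC : C.IsGood true N := ⟨hK.exists_sq, fun _ => hspan, nofun⟩
  refine (C.satisfies_iff φ fun _ v => nomatch v).trans ((h C hC _).trans ?_)
  refine (iff_of_eq (congrArg (P G.K) ?_)).trans (hσ G.K)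
  funext i
  rcases i with p | ⟨i, j⟩ | i
  · exact isEmptyElim p
  · refine (hb _ _).trans ?_
    simp [hyperbolicData, Frame.bit]
  · exact hq _

/-! ### Pseudo-finite fields -/

section Fields

open FirstOrder FirstOrder.Language FirstOrder.Ring

theorem definable_isArtinSchreierField :
    FieldPred.Definable.{u} (α := Empty) fun K _ _ => IsArtinSchreierField K := by
  have h1 : FieldPred.Definable.{u} (α := Empty) fun K _ _ =>
      ∀ a : Unit → K, ∃ b : Unit → K, b () ^ 2 = a () :=
    .forall_tuple (P := fun K _ _ a => ∃ b : Unit → K, b () ^ 2 = a ())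
      (.exists_tuple (α := Empty ⊕ Unit) (P := fun K _ c b => b () ^ 2 = c (.inr ()))
        (.equal (.sq (.proj _)) (.proj _)))
  have h2 : FieldPred.Definable.{u} (α := Empty) fun K _ _ =>
      ∃ a : Unit → K, ¬ IsArtinSchreier (a ()) :=
    .exists_tuple (P := fun K _ _ a => ¬ IsArtinSchreier (a ()))
      (definable_isArtinSchreier (.proj _)).not
  have h3 : FieldPred.Definable.{u} (α := Empty) fun K _ _ =>
      ∀ a : Bool → K, ¬ IsArtinSchreier (a true) → ¬ IsArtinSchreier (a false) →
        IsArtinSchreier (a true + a false) :=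
    .forall_tuple (P := fun K _ _ (a : Bool → K) => ¬ IsArtinSchreier (a true) →
        ¬ IsArtinSchreier (a false) → IsArtinSchreier (a true + a false))
      ((definable_isArtinSchreier (.proj _)).not.imp
        ((definable_isArtinSchreier (.proj _)).not.imp
          (definable_isArtinSchreier (.add (.proj _) (.proj _)))))
  refine (h1.and (h2.and h3)).congr fun K _ _ => ⟨fun h => ⟨fun a => ?_, ?_, fun a =>
    h.add_of_not _ _⟩, fun ⟨h1, ⟨a, h2⟩, h3⟩ => ⟨fun a => ?_, ⟨_, h2⟩, fun a b =>
      h3 (fun i => bif i then a else b)⟩⟩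
  · obtain ⟨b, hb⟩ := h.exists_sq (a ())
    exact ⟨fun _ => b, hb⟩
  · obtain ⟨a, ha⟩ := h.exists_not
    exact ⟨fun _ => a, ha⟩
  · obtain ⟨b, hb⟩ := h1 fun _ => a
    exact ⟨b (), hb⟩

variable {T : Language.ring.Theory}

theorem fieldSat_iff_mem (hT : IsCompletionPSF2 T) {K : Type u} [Field K]
    (hK : ∀ σ ∈ T, FieldSat K σ) (σ : Language.ring.Sentence) : FieldSat K σ ↔ σ ∈ T := by
  refine ⟨fun h => ?_, hK σ⟩
  rcases hT.2.mem_or_not_mem σ with h1 | h1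
  · exact h1
  · exact absurd h (hK _ h1)

theorem charP_of_completionPSF2 (hT : IsCompletionPSF2 T) {K : Type u} [Field K]
    (hK : ∀ σ ∈ T, FieldSat K σ) : CharP K 2 := by
  let _ := compatibleRingOfRing K
  have : (Theory.fieldOfChar 2).Model K := ⟨fun σ hσ => hK σ (hT.1 (Or.inr hσ))⟩
  exact Field.charP_of_model_fieldOfChar 2 K

theorem infinite_of_completionPSF2 (hT : IsCompletionPSF2 T) {K : Type u} [Field K]
    (hK : ∀ σ ∈ T, FieldSat K σ) : Infinite K := by
  let _ := compatibleRingOfRing K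
  exact (model_infiniteTheory_iff Language.ring).1
    ⟨fun σ hσ => hK σ (hT.1 (Or.inl (Or.inr hσ)))⟩

/-- A sentence true in a model of a completion of `PSF2` holds in some finite field of
characteristic `2`. -/
theorem exists_finite_of_completionPSF2 (hT : IsCompletionPSF2 T) {K : Type u} [Field K]
    (hK : ∀ σ ∈ T, FieldSat K σ) {σ : Language.ring.Sentence} (hσ : FieldSat K σ) :
    ∃ (F : Type u) (_ : Field F), Finite F ∧ CharP F 2 ∧ FieldSat F σ := by
  by_contra! hcon
  have := charP_of_completionPSF2 hT hK
  -- otherwise the sentence `2 = 0 → ¬ σ` holds in all finite fields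
  have hmem : (Field.eqZero 2).imp σ.not ∈ T := by
    refine hT.1 (Or.inl (Or.inl fun F _ _ _ => ?_))
    change F ⊨ Field.eqZero 2 → ¬ F ⊨ σ
    intro h2 hσF
    have h2' : ((2 : ℕ) : F) = 0 := (Field.realize_eqZero 2 _).1 h2
    have : CharP (ULift.{u} F) 2 := by
      refine (CharP.charP_iff_prime_eq_zero Nat.prime_two).2 ?_
      exact ULift.ext _ _ h2'
    refine hcon (ULift.{u} F) inferInstance inferInstance this ?_
    exact (FieldSat.congr ULift.ringEquiv.symm σ).1 ((realize_iff_fieldSat σ).1 hσF)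
  have h3 : FieldSat K (Field.eqZero 2) → ¬ FieldSat K σ := hK _ hmem
  refine h3 ?_ hσ
  let _ := compatibleRingOfRing K
  exact (Field.realize_eqZero 2 _).2 (CharP.cast_eq_zero K 2)

theorem isArtinSchreierField_of_completionPSF2 (hT : IsCompletionPSF2 T) {K : Type u} [Field K]
    (hK : ∀ σ ∈ T, FieldSat K σ) : IsArtinSchreierField K := by
  obtain ⟨σ, hσ⟩ := definable_isArtinSchreierField.{u}.exists_sentence
  rw [hσ K]
  by_contra h
  obtain ⟨F, _, _, _, hF⟩ := exists_finite_of_completionPSF2 hT hK ((fieldSat_not σ).2 h)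
  exact hF ((hσ F).1 (isArtinSchreierField_of_finite F))

theorem exists_model_of_completionPSF2 (hT : IsCompletionPSF2 T) :
    ∃ (K : Type u) (_ : Field K), ∀ σ ∈ T, FieldSat K σ := by
  obtain ⟨M⟩ := hT.2.1
  have h : ∀ σ ∈ T, M ⊨ σ := fun σ hσ => T.realize_sentence_of_mem hσ
  have : Theory.field.Model M := ⟨fun σ hσ => h σ (hT.1 (Or.inr (Or.inl hσ)))⟩
  let _ := Field.fieldOfModelField M
  let _ := Field.compatibleRingOfModelField M
  exact ⟨ULift.{u} M, inferInstance, fun σ hσ =>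
    (FieldSat.congr ULift.ringEquiv.symm σ).1 ((realize_iff_fieldSat σ).1 (h σ hσ))⟩

/-- The theory of an infinite field of characteristic `2`, all of whose sentences hold in some
finite field, is a completion of `PSF2`. -/
theorem isCompletionPSF2_of_infinite {K : Type u} [Field K] [CharP K 2] [Infinite K]
    (h : ∀ σ, FieldSat K σ → ∃ (F : Type u) (_ : Field F), Finite F ∧ FieldSat F σ) :
    IsCompletionPSF2 {σ | FieldSat K σ} := by
  let _ := compatibleRingOfRing K
  refine ⟨?_, completeTheory.isMaximal Language.ring K⟩
  rintro σ ((hσ | hσ) | hσ)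
  · by_contra hcon
    obtain ⟨F, _, _, hF⟩ := h _ ((fieldSat_not σ).2 hcon)
    -- `PSF2` refers to finite fields in `Type`
    let _ := compatibleRingOfRing (Shrink.{0} F)
    have h1 : Shrink.{0} F ⊨ σ := hσ (Shrink.{0} F)
    let e : Shrink.{0} F ≃+* F := (equivShrink.{0} F).symm.ringEquiv
    exact hF ((FieldSat.congr e σ).1 ((realize_iff_fieldSat σ).1 h1))
  · exact Theory.realize_sentence_of_mem (M := K) _ hσ
  · exact Theory.realize_sentence_of_mem (M := K) (Theory.fieldOfChar 2) hσ

end Fields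

/-! ### Completeness of the axioms -/

section Completeness

variable {w : Bool}

theorem isAxiomatizedModulo_of_forall_iff {X : Set (Sentence (lang w))} {M : Str.{u} (lang w)}
    (hM : M ∈ baseTheory.{u} w) (hX : ∀ ψ ∈ X, M.Satisfies ψ)
    (h : ∀ N ∈ baseTheory.{u} w, (∀ ψ ∈ X, N.Satisfies ψ) →
      ∀ φ : Sentence (lang w), M.Satisfies φ ↔ N.Satisfies φ) :
    IsAxiomatizedModulo (baseTheory.{u} w) X M :=
  fun φ => ⟨fun hφ N hN hNX => (h N hN hNX φ).1 hφ, fun hφ => hφ M hM hX⟩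

variable {G : QuadraticGeometry.{u}} {ω : w = true → G.Q → G.K}

theorem isAxiomatizedModulo_finiteFieldAxioms (hω : ∀ h, G.IsWittDefect (ω h))
    (hQ : Nonempty G.Q) (hV : ∀ m, ∃ f : Fin m → G.V, LinearIndependent G.K f) {k : ℕ}
    (hk : Cardinal.mk G.K = (2 ^ k : ℕ)) :
    IsAxiomatizedModulo (baseTheory w) (finiteFieldAxioms w k) (G.toStr w ω) := by
  refine isAxiomatizedModulo_of_forall_iff ⟨G, ω, hω, rfl⟩ ?_ ?_
  · rintro ψ ((rfl | ⟨m, rfl⟩) | rfl)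
    · exact (satisfies_cardKEq G ω _).2 hk
    · exact (satisfies_dimGe G ω m).2 (hV m)
    · exact (satisfies_nonemptyQ G ω).2 hQ
  · rintro _ ⟨G', ω', hω', rfl⟩ hX φ
    have hk' : Cardinal.mk G'.K = (2 ^ k : ℕ) :=
      (satisfies_cardKEq G' ω' _).1 (hX _ (.inl (.inl rfl)))
    have hV' : ∀ m, ∃ f : Fin m → G'.V, LinearIndependent G'.K f := fun m =>
      (satisfies_dimGe G' ω' m).1 (hX _ (.inl (.inr ⟨m, rfl⟩)))
    have hQ' : Nonempty G'.Q := (satisfies_nonemptyQ G' ω').1 (hX _ (.inr rfl))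
    have : Finite G.K := Cardinal.mk_lt_aleph0_iff.1 (hk ▸ Cardinal.natCast_lt_aleph0)
    have : Finite G'.K := Cardinal.mk_lt_aleph0_iff.1 (hk' ▸ Cardinal.natCast_lt_aleph0)
    have := Fintype.ofFinite G.K
    have := Fintype.ofFinite G'.K
    obtain ⟨N, σ, hσ⟩ := exists_sentence_of_large_dim.{u} w φ
    rw [hσ G ω hω (isArtinSchreierField_of_finite G.K) hQ (hV N),
      hσ G' ω' hω' (isArtinSchreierField_of_finite G'.K) hQ' (hV' N)]
    refine FieldSat.congr (FiniteField.ringEquivOfCardEq ?_) σ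
    exact Fintype.card_eq.2 (Cardinal.eq.1 (hk.trans hk'.symm))

variable {T : FirstOrder.Language.ring.Theory}

theorem fieldSat_iff_of_satisfies (hT : IsCompletionPSF2 T) (hK : ∀ σ ∈ T, FieldSat G.K σ)
    {G' : QuadraticGeometry.{u}} (hK' : ∀ σ ∈ T, FieldSat G'.K σ)
    (σ : FirstOrder.Language.ring.Sentence) : FieldSat G.K σ ↔ FieldSat G'.K σ :=
  (fieldSat_iff_mem hT hK σ).trans (fieldSat_iff_mem hT hK' σ).symm

theorem isAxiomatizedModulo_infiniteDimAxioms (hω : ∀ h, G.IsWittDefect (ω h))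
    (hQ : Nonempty G.Q) (hV : ∀ m, ∃ f : Fin m → G.V, LinearIndependent G.K f)
    (hT : IsCompletionPSF2 T) (hK : ∀ σ ∈ T, FieldSat G.K σ) :
    IsAxiomatizedModulo (baseTheory w) (infiniteDimAxioms w T) (G.toStr w ω) := by
  refine isAxiomatizedModulo_of_forall_iff ⟨G, ω, hω, rfl⟩ ?_ ?_
  · rintro ψ ((⟨σ, hσ, rfl⟩ | ⟨m, rfl⟩) | rfl)
    · exact (satisfies_aboutK G ω σ).2 (hK σ hσ)
    · exact (satisfies_dimGe G ω m).2 (hV m)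
    · exact (satisfies_nonemptyQ G ω).2 hQ
  · rintro _ ⟨G', ω', hω', rfl⟩ hX φ
    have hK' : ∀ σ ∈ T, FieldSat G'.K σ := fun σ hσ =>
      (satisfies_aboutK G' ω' σ).1 (hX _ (.inl (.inl ⟨σ, hσ, rfl⟩)))
    have hV' : ∀ m, ∃ f : Fin m → G'.V, LinearIndependent G'.K f := fun m =>
      (satisfies_dimGe G' ω' m).1 (hX _ (.inl (.inr ⟨m, rfl⟩)))
    have hQ' : Nonempty G'.Q := (satisfies_nonemptyQ G' ω').1 (hX _ (.inr rfl))
    obtain ⟨N, σ, hσ⟩ := exists_sentence_of_large_dim.{u} w φ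
    rw [hσ G ω hω (isArtinSchreierField_of_completionPSF2 hT hK) hQ (hV N),
      hσ G' ω' hω' (isArtinSchreierField_of_completionPSF2 hT hK') hQ' (hV' N)]
    exact fieldSat_iff_of_satisfies hT hK hK' σ

theorem isAxiomatizedModulo_finiteDimAxioms (hω : ∀ h, G.IsWittDefect (ω h))
    (hQ : Nonempty G.Q) [hfin : Module.Finite G.K G.V] {n : ℕ}
    (hV : Module.finrank G.K G.V = 2 * n)
    (hT : IsCompletionPSF2 T) (hK : ∀ σ ∈ T, FieldSat G.K σ) :
    IsAxiomatizedModulo (baseTheory w) (finiteDimAxioms w T n) (G.toStr w ω) := by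
  refine isAxiomatizedModulo_of_forall_iff ⟨G, ω, hω, rfl⟩ ?_ ?_
  · rintro ψ ((⟨σ, hσ, rfl⟩ | rfl) | rfl)
    · exact (satisfies_aboutK G ω σ).2 (hK σ hσ)
    · exact satisfies_dimEq G ω hV
    · exact (satisfies_nonemptyQ G ω).2 hQ
  · rintro _ ⟨G', ω', hω', rfl⟩ hX φ
    have hK' : ∀ σ ∈ T, FieldSat G'.K σ := fun σ hσ =>
      (satisfies_aboutK G' ω' σ).1 (hX _ (.inl (.inl ⟨σ, hσ, rfl⟩)))
    obtain ⟨hfin', hV'⟩ := finrank_eq_of_dimEq G' ω' (hX _ (.inl (.inr rfl)))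
    have hQ' : Nonempty G'.Q := (satisfies_nonemptyQ G' ω').1 (hX _ (.inr rfl))
    obtain ⟨σ, hσ⟩ := exists_sentence_of_finrank_eq.{u} w n φ
    rw [hσ G ω hω (isArtinSchreierField_of_completionPSF2 hT hK) hQ hfin hV,
      hσ G' ω' hω' (isArtinSchreierField_of_completionPSF2 hT hK') hQ' hfin' hV']
    exact fieldSat_iff_of_satisfies hT hK hK' σ

end Completeness

/-! ### Pseudo-finite geometries -/

section PseudoFinite

variable (w : Bool) (K : Type u) [Field K] [CharP K 2] (I : Type)

/-- The standard model of `T⁰`. -/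
noncomputable abbrev standardStr : Str.{u} (lang w) :=
  (standard K I).toStr w fun _ => standardDefect K I

variable {K}

theorem standardStr_mem (hK : IsArtinSchreierField K) : standardStr w K I ∈ baseTheory w :=
  ⟨standard K I, _, fun _ => isWittDefect_standard hK, rfl⟩

variable (K)

instance : Nonempty (standard K I).Q := ⟨(0 : (I →₀ K) × (I →₀ K))⟩

theorem isFinite_standardStr [Finite K] [Finite I] : (standardStr w K I).IsFinite := by
  have hV : Finite ((I →₀ K) × (I →₀ K)) := Module.finite_of_finite K
  intro s
  cases s
  · exact inferInstanceAs (Finite K)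
  · exact hV
  · exact hV

theorem exists_linearIndependent_standard_nat (m : ℕ) :
    ∃ f : Fin m → (standard K ℕ).V, LinearIndependent (standard K ℕ).K f := by
  refine exists_linearIndependent_of_not_finite _ (fun h => ?_) m
  exact not_finite_iff_infinite.2 (inferInstanceAs (Infinite ℕ)) (finite_of_finite_standard h)

theorem exists_linearIndependent_standard_fin (N : ℕ) :
    ∃ f : Fin N → (standard K (Fin N)).V, LinearIndependent (standard K (Fin N)).K f := by
  have : Module.Finite (standard K (Fin N)).K (standard K (Fin N)).V :=
    inferInstanceAs (Module.Finite K ((Fin N →₀ K) × (Fin N →₀ K)))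
  refine exists_linearIndependent_of_le_finrank ?_
  rw [finrank_standard, Fintype.card_fin]
  omega

/-- The infinite-dimensional standard geometry over `K` is pseudo-finite if each sentence that is
true in `K` is true in some finite field of characteristic `2`. -/
theorem isPseudoFinite_standard_nat (hK : IsArtinSchreierField K)
    (h : ∀ σ, FieldSat K σ →
      ∃ (F : Type u) (_ : Field F), Finite F ∧ CharP F 2 ∧ FieldSat F σ) :
    IsPseudoFinite (baseTheory w) (standardStr w K ℕ) := by
  refine ⟨standardStr_mem w ℕ hK, fun hfin => ?_, fun φ hφ => ?_⟩
  · have : Finite ((ℕ →₀ K) × (ℕ →₀ K)) := hfin .V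
    have : Finite (ℕ →₀ K) := Finite.of_surjective _ (Prod.fst_surjective (β := ℕ →₀ K))
    exact not_finite (ℕ →₀ K)
  · obtain ⟨N, σ, hσ⟩ := exists_sentence_of_large_dim.{u} w φ
    have hσK := (hσ (standard K ℕ) _ (fun _ => isWittDefect_standard hK) hK inferInstance
      (exists_linearIndependent_standard_nat K N)).1 hφ
    obtain ⟨F, _, _, _, hF⟩ := h σ hσK
    have hF' := isArtinSchreierField_of_finite F
    exact ⟨standardStr w F (Fin N), standardStr_mem w _ hF', isFinite_standardStr w F _,
      (hσ (standard F (Fin N)) _ (fun _ => isWittDefect_standard hF') hF' inferInstance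
        (exists_linearIndependent_standard_fin F N)).2 hF⟩

/-- The standard geometry of dimension `2 n` over an infinite field `K` is pseudo-finite if each
sentence that is true in `K` is true in some finite field of characteristic `2`. -/
theorem isPseudoFinite_standard_fin [Infinite K] (hK : IsArtinSchreierField K) (n : ℕ)
    (h : ∀ σ, FieldSat K σ →
      ∃ (F : Type u) (_ : Field F), Finite F ∧ CharP F 2 ∧ FieldSat F σ) :
    IsPseudoFinite (baseTheory w) (standardStr w K (Fin n)) := by
  have hfin : ∀ (F : Type u) [Field F] [CharP F 2],
      Module.Finite (standard F (Fin n)).K (standard F (Fin n)).V := fun F _ _ =>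
    inferInstanceAs (Module.Finite F ((Fin n →₀ F) × (Fin n →₀ F)))
  have hdim : ∀ (F : Type u) [Field F] [CharP F 2],
      Module.finrank (standard F (Fin n)).K (standard F (Fin n)).V = 2 * n := fun F _ _ => by
    rw [finrank_standard, Fintype.card_fin]
  refine ⟨standardStr_mem w _ hK, fun hfin => ?_, fun φ hφ => ?_⟩
  · have : Finite K := hfin .K
    exact not_finite K
  · obtain ⟨σ, hσ⟩ := exists_sentence_of_finrank_eq.{u} w n φ
    have hσK := (hσ (standard K (Fin n)) _ (fun _ => isWittDefect_standard hK) hK inferInstance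
      (hfin K) (hdim K)).1 hφ
    obtain ⟨F, _, _, _, hF⟩ := h σ hσK
    have hF' := isArtinSchreierField_of_finite F
    exact ⟨standardStr w F (Fin n), standardStr_mem w _ hF', isFinite_standardStr w F _,
      (hσ (standard F (Fin n)) _ (fun _ => isWittDefect_standard hF') hF' inferInstance
        (hfin F) (hdim F)).2 hF⟩

variable {w K}

/-- If the field of an infinite geometry with `Q ≠ ∅` is finite, then the dimension
is infinite. -/
theorem not_finite_of_not_isFinite {G : QuadraticGeometry.{u}} {ω : w = true → G.Q → G.K}
    (hG : ¬ (G.toStr w ω).IsFinite) (q : G.Q) [Finite G.K] : ¬ Module.Finite G.K G.V := by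
  intro hfin
  have hV : Finite G.V := Module.finite_of_finite G.K
  have hQ : Finite G.Q := Finite.of_surjective _ (G.addQ_surjective q)
  refine hG fun s => ?_
  cases s
  · exact inferInstanceAs (Finite G.K)
  · exact hV
  · exact hQ

theorem isCompletionPSF2_of_isPseudoFinite {G : QuadraticGeometry.{u}}
    {ω : w = true → G.Q → G.K} (hG : IsPseudoFinite (baseTheory w) (G.toStr w ω))
    [Infinite G.K] : IsCompletionPSF2 {σ | FieldSat G.K σ} := by
  refine isCompletionPSF2_of_infinite fun σ hσ => ?_
  obtain ⟨_, ⟨G', ω', -, rfl⟩, hfin, hσ'⟩ := hG.2.2 _ ((satisfies_aboutK G ω σ).2 hσ)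
  exact ⟨G'.K, inferInstance, hfin .K, (satisfies_aboutK G' ω' σ).1 hσ'⟩

end PseudoFinite

end QuadGeom

theorem mainTheorem5 (w : Bool) :
    (∀ M : ManySorted.Str.{u} (QuadGeom.lang w),
      ManySorted.IsPseudoFinite (QuadGeom.baseTheory w) M → Nonempty (M.Carrier QuadGeom.Srt.Q) →
        (∃ k : ℕ, 1 ≤ k ∧
          ManySorted.IsAxiomatizedModulo (QuadGeom.baseTheory w)
            (QuadGeom.finiteFieldAxioms w k) M) ∨
        (∃ T : FirstOrder.Language.ring.Theory, QuadGeom.IsCompletionPSF2 T ∧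
          ((∃ n : ℕ, ManySorted.IsAxiomatizedModulo (QuadGeom.baseTheory w)
              (QuadGeom.finiteDimAxioms w T n) M) ∨
            ManySorted.IsAxiomatizedModulo (QuadGeom.baseTheory w)
              (QuadGeom.infiniteDimAxioms w T) M))) ∧
    (∀ k : ℕ, 1 ≤ k → ∃ M : ManySorted.Str.{u} (QuadGeom.lang w),
      ManySorted.IsPseudoFinite (QuadGeom.baseTheory w) M ∧
        Nonempty (M.Carrier QuadGeom.Srt.Q) ∧
        ManySorted.IsAxiomatizedModulo (QuadGeom.baseTheory w)
          (QuadGeom.finiteFieldAxioms w k) M) ∧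
    (∀ T : FirstOrder.Language.ring.Theory, QuadGeom.IsCompletionPSF2 T →
      (∀ n : ℕ, ∃ M : ManySorted.Str.{u} (QuadGeom.lang w),
        ManySorted.IsPseudoFinite (QuadGeom.baseTheory w) M ∧
          Nonempty (M.Carrier QuadGeom.Srt.Q) ∧
          ManySorted.IsAxiomatizedModulo (QuadGeom.baseTheory w)
            (QuadGeom.finiteDimAxioms w T n) M) ∧
      (∃ M : ManySorted.Str.{u} (QuadGeom.lang w),
        ManySorted.IsPseudoFinite (QuadGeom.baseTheory w) M ∧
          Nonempty (M.Carrier QuadGeom.Srt.Q) ∧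
          ManySorted.IsAxiomatizedModulo (QuadGeom.baseTheory w)
            (QuadGeom.infiniteDimAxioms w T) M)) := by
  open QuadGeom in
  refine ⟨fun M hM hQ => ?_, fun k hk => ?_, fun T hT => ?_⟩
  · obtain ⟨G, ω, hω, rfl⟩ := hM.1
    have hQ : Nonempty G.Q := hQ
    obtain ⟨q⟩ := hQ
    rcases finite_or_infinite G.K with hK | hK
    · left
      have := Fintype.ofFinite G.K
      obtain ⟨k, -, hk⟩ := FiniteField.card G.K 2
      refine ⟨k, k.2, isAxiomatizedModulo_finiteFieldAxioms hω ⟨q⟩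
        (exists_linearIndependent_of_not_finite G (not_finite_of_not_isFinite hM.2.1 q)) ?_⟩
      rw [Cardinal.mk_fintype, hk]
    · right
      refine ⟨_, isCompletionPSF2_of_isPseudoFinite hM, ?_⟩
      by_cases hfin : Module.Finite G.K G.V
      · obtain ⟨n, b, hb, hs⟩ := G.exists_symplectic_basis
        exact .inl ⟨n, isAxiomatizedModulo_finiteDimAxioms hω ⟨q⟩ (hb.finrank_eq hs)
          (isCompletionPSF2_of_isPseudoFinite hM) fun σ hσ => hσ⟩
      · exact .inr (isAxiomatizedModulo_infiniteDimAxioms hω ⟨q⟩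
          (exists_linearIndependent_of_not_finite G hfin)
          (isCompletionPSF2_of_isPseudoFinite hM) fun σ hσ => hσ)
  · let F := ULift.{u} (GaloisField 2 k)
    have : CharP F 2 :=
    (ULift.ringEquiv (R := GaloisField 2 k)).toRingHom.charP (RingHom.injective _) 2
    have hF := isArtinSchreierField_of_finite F
    refine ⟨standardStr w F ℕ, isPseudoFinite_standard_nat w F hF fun σ hσ =>
      ⟨F, inferInstance, inferInstance, this, hσ⟩,
      (inferInstance : Nonempty (standard F ℕ).Q),
      isAxiomatizedModulo_finiteFieldAxioms (fun _ => isWittDefect_standard hF) inferInstance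
        (exists_linearIndependent_standard_nat F) ?_⟩
    change Cardinal.mk F = _
    rw [← Nat.cast_card, Nat.card_congr Equiv.ulift, GaloisField.card 2 k (by omega)]
  · obtain ⟨K, _, hK⟩ := exists_model_of_completionPSF2.{u} hT
    have := charP_of_completionPSF2 hT hK
    have := infinite_of_completionPSF2 hT hK
    have hK' := isArtinSchreierField_of_completionPSF2 hT hK
    have hfin : ∀ σ, FieldSat K σ →
        ∃ (F : Type u) (_ : Field F), Finite F ∧ CharP F 2 ∧ FieldSat F σ :=
      fun σ hσ => exists_finite_of_completionPSF2 hT hK hσ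
    refine ⟨fun n => ⟨standardStr w K (Fin n), isPseudoFinite_standard_fin w K hK' n hfin,
      (inferInstance : Nonempty (standard K (Fin n)).Q), ?_⟩,
      standardStr w K ℕ, isPseudoFinite_standard_nat w K hK' hfin,
      (inferInstance : Nonempty (standard K ℕ).Q),
      isAxiomatizedModulo_infiniteDimAxioms (fun _ => isWittDefect_standard hK') inferInstance
        (exists_linearIndependent_standard_nat K) hT hK⟩
    have : Module.Finite (standard K (Fin n)).K (standard K (Fin n)).V :=
      inferInstanceAs (Module.Finite K ((Fin n →₀ K) × (Fin n →₀ K)))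
    exact isAxiomatizedModulo_finiteDimAxioms (fun _ => isWittDefect_standard hK') inferInstance
      (by rw [finrank_standard, Fintype.card_fin]) hT hK
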